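/- **Theorem (System identification).** There is an absolute constant $C>0$ for which the following holds. *Setting.* Consider $m\ge 1$ agents with identical dynamics $x_{i,t+1}=Ax_{i,t}+Bu_{i,t}+w_t$, $x_{i,1}=0$ ($i\in[m]$, $t\ge 1$), where $A\in\mathbb R^{d_1\times d_1}$, $B\in\mathbb R^{d_1\times d_2}$, $d_1,d_2\ge 1$. Norms are Euclidean (vectors) and spectral (matrices). Let $\kappa,W\ge 1$, $\delta\in(0,1)$, and assume: 1. $\|A\|,\|B\|\le\kappa$, and $(w_t)$ is an arbitrary sequence, fixed in advance, with $\|w_t\|\le W$. 2. All agents know a matrix $K$ that is $(\kappa,\gamma)$-strongly stable for $(A,B)$: $0<\gamma\le1$, $\|K\|\le\kappa$, and $A-BK=HLH^{-1}$ with $\|L\|\le1-\gamma$ and $\|H\|,\|H^{-1}\|\le\kappa$. 3. $(A-BK,B)$ is $(q,\kappa)$-strongly controllable: $q\ge1$ and, for $C_q=[B,(A-BK)B,\dots,(A-BK)^{q-1}B]$, the matrix $C_qC_q^\top$ is invertible with $\|(C_qC_q^\top)^{-1}\|\le\kappa$. 4. $P\in\mathbb R^{m\times m}$ is symmetric and doubly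 stochastic with positive diagonal, and the graph of its positive off-diagonal entries is connected; $\beta$ denotes its second largest singular value ($\beta=0$ if $m=1$). *Algorithm.* For $t=1,\dots,T_{collect}$, where $T_{collect}>q+1$, agent $i$ applies $u_{i,t}=-Kx_{i,t}+\xi_{i,t}$, where the $\xi_{i,t}$ are i.i.d. (over all $i$ and $t$) uniform on $\{\pm1\}^{d_2}$. For $0\le l\le q$ it forms $$N^{T_{collect}}_{i,l}=\frac1{T_{collect}-(q+1)}\sum_{t=1}^{T_{collect}-(q+1)}x_{i,t+l+1}\,\xi_{i,t}^\top .$$ Then the agents average for $T_{exchange}$ rounds, $N^{t}_{i,l}=\sum_{j}P_{ji}N^{t-1}_{j,l}$ for $t=T_{collect}+1,\dots,T_0$, where $T_0=T_{collect}+T_{exchange}$. With $C_{i,0}=[N^{T_0}_{i,0},\dots,N^{T_0}_{i,q-1}]$ and $C_{i,1}=[N^{T_0}_{i,1},\dots,N^{T_0}_{i,q}]$, agent $i$ returns $$\widehat B_i=N^{T_0}_{i,0},\qquad \widehat A_i=C_{i,1}C_{i,0}^\top(C_{i,0}C_{i,0}^\top)^{-1}+\widehat B_iK .$$ *Claim.*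 Put $\Lambda=\log\big(d_1d_2(q+1)m/\delta\big)$ and $S=m\,(T_{collect}-(q+1))$. If $T_{collect}$ and $T_{exchange}$ are large enough that $$S\ \ge\ C\,\frac{q\,d_2^2\,\kappa^7W^2}{\gamma^2}\,\Lambda\qquad\text{and}\qquad \sqrt m\,\beta^{T_{exchange}}\le\sqrt{\frac{2\Lambda}{S}},$$ then with probability at least $1-\delta$, simultaneously for all $i\in[m]$, the matrix $C_{i,0}C_{i,0}^\top$ is invertible (so the estimates are well defined) and $$\|\widehat A_i-A\|\le\epsilon_{A,B},\quad \|\widehat B_i-B\|\le\epsilon_{A,B},\qquad \epsilon_{A,B}=C\,\frac{d_2W\sqrt{d_1q}\,\kappa^{11/2}}{\gamma}\sqrt{\frac{\log\big(d_1d_2(q+1)m/\delta\big)}{m\,(T_{collect}-(q+1))}} .$$ -/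

import Mathlib

open MeasureTheory ProbabilityTheory
open scoped Matrix Matrix.Norms.L2Operator

/-! Throughout, `‖·‖` of a matrix is the spectral norm (the scoped instances of
`Matrix.Norms.L2Operator`); vectors are plain functions `Fin d → ℝ`, and the Euclidean norm of
`v` is written `‖WithLp.toLp 2 v‖`. -/

noncomputable section

namespace DistributedSysId

/-- The policy `u = -K x` is `(κ, γ)`-strongly stable for the system `(A, B)`. -/
def StronglyStable {d₁ d₂ : ℕ} (A : Matrix (Fin d₁) (Fin d₁) ℝ) (B : Matrix (Fin d₁) (Fin d₂) ℝ)
    (K : Matrix (Fin d₂) (Fin d₁) ℝ) (κ γ : ℝ) : Prop :=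
  0 < κ ∧ 0 < γ ∧ γ ≤ 1 ∧ ‖K‖ ≤ κ ∧
    ∃ L H : Matrix (Fin d₁) (Fin d₁) ℝ, IsUnit H ∧ A - B * K = H * L * H⁻¹ ∧
      ‖L‖ ≤ 1 - γ ∧ ‖H‖ ≤ κ ∧ ‖H⁻¹‖ ≤ κ

/-- The block row `[N 0, N 1, …, N (q-1)]` of `d₁ × d₂` matrices, a `d₁ × (q d₂)` matrix. -/
def blockRow {d₁ d₂ : ℕ} (q : ℕ) (N : ℕ → Matrix (Fin d₁) (Fin d₂) ℝ) :
    Matrix (Fin d₁) (Fin q × Fin d₂) ℝ :=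
  Matrix.of fun a p => N (p.1 : ℕ) a p.2

/-- `C_q = [B, A B, …, A^(q-1) B]`. -/
def controllabilityMatrix {d₁ d₂ : ℕ} (A : Matrix (Fin d₁) (Fin d₁) ℝ)
    (B : Matrix (Fin d₁) (Fin d₂) ℝ) (q : ℕ) : Matrix (Fin d₁) (Fin q × Fin d₂) ℝ :=
  blockRow q fun l => A ^ l * B

/-- `(A, B)` is `(q, κ)`-strongly controllable. -/
def StronglyControllable {d₁ d₂ : ℕ} (A : Matrix (Fin d₁) (Fin d₁) ℝ)
    (B : Matrix (Fin d₁) (Fin d₂) ℝ) (q : ℕ) (κ : ℝ) : Prop :=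
  1 ≤ q ∧ IsUnit (controllabilityMatrix A B q * (controllabilityMatrix A B q)ᵀ) ∧
    ‖(controllabilityMatrix A B q * (controllabilityMatrix A B q)ᵀ)⁻¹‖ ≤ κ

/-- The weight matrix of the communication network: symmetric, doubly stochastic, with positive
diagonal, and with connected graph of positive off-diagonal weights. -/
structure IsNetworkMatrix {m : ℕ} (P : Matrix (Fin m) (Fin m) ℝ) : Prop where
  symm : P.IsSymm
  doublyStochastic : P ∈ doublyStochastic ℝ (Fin m)
  diag_pos : ∀ i, 0 < P i i
  connected : (SimpleGraph.fromRel fun i j => 0 < P i j).Connected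

/-- The second largest singular value of `P` (singular values are indexed from `0`, in
nonincreasing order, with multiplicity; the value is `0` for a `1 × 1` matrix). -/
def secondSingularValue {m : ℕ} (P : Matrix (Fin m) (Fin m) ℝ) : ℝ :=
  (Matrix.toEuclideanLin P).singularValues 1

/-- The sign vectors `{±1}^d`. -/
def signCube (d : ℕ) : Set (Fin d → ℝ) := {v | ∀ a, v a = 1 ∨ v a = -1}

/-- The exploration signals `ξ i t` of agents `i` at times `t` are i.i.d. uniform on `{±1}^d`,
independent over all pairs `(i, t)`. -/
structure IsExplorationNoise {m d : ℕ} {Ω : Type*} [MeasurableSpace Ω] (μ : Measure Ω)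
    (ξ : Fin m → ℕ → Ω → (Fin d → ℝ)) : Prop where
  measurable : ∀ i t, Measurable (ξ i t)
  law : ∀ i t, μ.map (ξ i t) = uniformOn (signCube d)
  indep : iIndepFun (fun p : Fin m × ℕ => ξ p.1 p.2) μ

/-- The exploration control `u = -K x + ξ`. -/
def explorationControl {d₁ d₂ : ℕ} (K : Matrix (Fin d₂) (Fin d₁) ℝ) (x : Fin d₁ → ℝ)
    (ξ : Fin d₂ → ℝ) : Fin d₂ → ℝ :=
  -(K *ᵥ x) + ξ

/-- The state of one agent: `x₁ = 0` and `x_{t+1} = A x_t + B u_t + w_t` for `t ≥ 1`, under the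
exploration control. Time starts at `1`; the value at time `0` is a dummy. -/
def explorationState {d₁ d₂ : ℕ} (A : Matrix (Fin d₁) (Fin d₁) ℝ)
    (B : Matrix (Fin d₁) (Fin d₂) ℝ) (K : Matrix (Fin d₂) (Fin d₁) ℝ)
    (w : ℕ → Fin d₁ → ℝ) (ξ : ℕ → Fin d₂ → ℝ) : ℕ → Fin d₁ → ℝ
  | 0 => 0
  | 1 => 0
  | t + 2 =>
      A *ᵥ explorationState A B K w ξ (t + 1) +
        B *ᵥ explorationControl K (explorationState A B K w ξ (t + 1)) (ξ (t + 1)) + w (t + 1)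

/-- The moment `N_l = 1 / (T_c - (q+1)) ∑_{t=1}^{T_c-(q+1)} x_{t+l+1} ξ_tᵀ` of one agent's data
(`0 ≤ l ≤ q`). -/
def localMoment {d₁ d₂ : ℕ} (q Tc : ℕ) (x : ℕ → Fin d₁ → ℝ) (ξ : ℕ → Fin d₂ → ℝ) (l : ℕ) :
    Matrix (Fin d₁) (Fin d₂) ℝ :=
  (1 / ((Tc : ℝ) - ((q : ℝ) + 1))) •
    ∑ t ∈ Finset.Icc 1 (Tc - (q + 1)), Matrix.vecMulVec (x (t + l + 1)) (ξ t)

/-- `s` rounds of consensus averaging `N_i ← ∑_j P_{ji} N_j`. -/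
def exchange {m d₁ d₂ : ℕ} (P : Matrix (Fin m) (Fin m) ℝ)
    (N : Fin m → Matrix (Fin d₁) (Fin d₂) ℝ) : ℕ → Fin m → Matrix (Fin d₁) (Fin d₂) ℝ
  | 0 => N
  | s + 1 => fun i => ∑ j, P j i • exchange P N s j

/-- Agent `i`'s moments `l ↦ N_{i,l}` after `Tc` exploration steps and `Te` exchange rounds. -/
def finalMoment {m d₁ d₂ : ℕ} (A : Matrix (Fin d₁) (Fin d₁) ℝ) (B : Matrix (Fin d₁) (Fin d₂) ℝ)
    (K : Matrix (Fin d₂) (Fin d₁) ℝ) (P : Matrix (Fin m) (Fin m) ℝ) (q Tc Te : ℕ)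
    (w : ℕ → Fin d₁ → ℝ) (ξ : Fin m → ℕ → Fin d₂ → ℝ) (i : Fin m) (l : ℕ) :
    Matrix (Fin d₁) (Fin d₂) ℝ :=
  exchange P (fun j => localMoment q Tc (explorationState A B K w (ξ j)) (ξ j) l) Te i

/-- `C₀ = [N_0, …, N_{q-1}]`. -/
def regressor {d₁ d₂ : ℕ} (q : ℕ) (N : ℕ → Matrix (Fin d₁) (Fin d₂) ℝ) :
    Matrix (Fin d₁) (Fin q × Fin d₂) ℝ :=
  blockRow q N

/-- `C₁ = [N_1, …, N_q]`. -/
def response {d₁ d₂ : ℕ} (q : ℕ) (N : ℕ → Matrix (Fin d₁) (Fin d₂) ℝ) :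
    Matrix (Fin d₁) (Fin q × Fin d₂) ℝ :=
  blockRow q fun l => N (l + 1)

/-- `B̂ = N_0`. -/
def estimateB {d₁ d₂ : ℕ} (N : ℕ → Matrix (Fin d₁) (Fin d₂) ℝ) : Matrix (Fin d₁) (Fin d₂) ℝ :=
  N 0

/-- `Â = C₁ C₀ᵀ (C₀ C₀ᵀ)⁻¹ + B̂ K`. -/
def estimateA {d₁ d₂ : ℕ} (q : ℕ) (K : Matrix (Fin d₂) (Fin d₁) ℝ)
    (N : ℕ → Matrix (Fin d₁) (Fin d₂) ℝ) : Matrix (Fin d₁) (Fin d₁) ℝ :=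
  response q N * (regressor q N)ᵀ * (regressor q N * (regressor q N)ᵀ)⁻¹ + estimateB N * K

/-- The logarithmic factor `log (d₁ d₂ (q+1) m / δ)`. -/
def logFactor (m d₁ d₂ q : ℕ) (δ : ℝ) : ℝ :=
  Real.log ((d₁ : ℝ) * d₂ * ((q : ℝ) + 1) * m / δ)

/-- The number `m (T_c - (q+1))` of samples used by all agents together. -/
def sampleSize (m q Tc : ℕ) : ℝ := (m : ℝ) * ((Tc : ℝ) - ((q : ℝ) + 1))

/-- The rate `(d₂ W √(d₁ q) κ^(11/2) / γ) √(log (d₁ d₂ (q+1) m / δ) / (m (T_c - (q+1))))`. -/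
def estimationRate (m d₁ d₂ q Tc : ℕ) (κ γ W δ : ℝ) : ℝ :=
  (d₂ : ℝ) * W * Real.sqrt ((d₁ : ℝ) * q) * κ ^ (11 / 2 : ℝ) / γ *
    Real.sqrt (logFactor m d₁ d₂ q δ / sampleSize m q Tc)

end DistributedSysId

end

/-! ### McDiarmid's inequality in Hilbert spaces, for uniform finite product spaces -/

/-! Write Ac = A - BK. Unrolling the closed loop expresses x_{t+l+1} as the sum of Ac^k (B ξ_{t+l-k}
+ w_{t+l-k}). After multiplication by ξ_tᵀ and averaging over the signs only k = l survives, so each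
moment N_l has mean exactly Ac^l B, whatever the disturbances are (`sum_localMoment_sub`).

The moment averaged over agents is a function of finitely many independent uniform sign vectors,
with values in the Hilbert space of matrices under the Frobenius norm. Strong stability makes the
influence of one signal on later states decay geometrically, so changing it moves the average by
O(M/S), where M = κ³ d₂ W / γ. A McDiarmid inequality whose constants do not depend on the dimension
(`card_norm_sub_ge_le`) then gives a deviation of order M √(Λ/S), simultaneously for the q + 1 lags
by a union bound. All of this is counting of sign patterns; `IsExplorationNoise.le_measure` turns
the count into a probability.

Consensus replaces the exact average by a gossip average, at a cost of √m β^Te times the size of a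
moment (`IsNetworkMatrix.norm_exchange_sub_mean_le`), which is of the same order by assumption.

Finally [Ac B, …, Ac^q B] = Ac C_q, so least squares recovers Ac, stably once the regressor is
within 1/(2√κ) of C_q (`estimates_of_moments_close`). The lower bound on S provides exactly this. -/

/-- The power series of cosh has nonnegative coefficients and even powers only, so cosh is a convex
increasing function of the square of its argument; the comparison is made term by term. -/
theorem Real.cosh_le_of_sq_le_convexComb {x y z θ : ℝ} (h0 : 0 ≤ θ) (h1 : θ ≤ 1)
    (h : z ^ 2 ≤ (1 - θ) * x ^ 2 + θ * y ^ 2) :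
    Real.cosh z ≤ (1 - θ) * Real.cosh x + θ * Real.cosh y := by
  refine hasSum_le (fun n => ?_) (Real.hasSum_cosh z)
    (((Real.hasSum_cosh x).mul_left (1 - θ)).add ((Real.hasSum_cosh y).mul_left θ))
  have hc := (convexOn_pow (𝕜 := ℝ) n).2 (x := x ^ 2) (y := y ^ 2) (sq_nonneg x) (sq_nonneg y)
    (sub_nonneg.2 h1) h0 (by ring)
  simp only [smul_eq_mul] at hc
  have := (pow_le_pow_left₀ (sq_nonneg z) h n).trans hc
  simp only [← pow_mul] at this
  rw [← mul_div_assoc, ← mul_div_assoc, ← add_div]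
  gcongr

section Concentration

variable {E : Type*} [NormedAddCommGroup E] [InnerProductSpace ℝ E]

/-- The right-hand side is affine in X, so its last term disappears when X is averaged with mean
zero. This serves as the one-step bound for martingales in a Hilbert space. If v = 0 or c = 0,
division by zero makes the last term vanish. -/
theorem cosh_norm_add_le (v X : E) {c : ℝ} (hX : ‖X‖ ≤ c) :
    Real.cosh ‖v + X‖ ≤ Real.cosh ‖v‖ * Real.cosh c +
      Real.sinh ‖v‖ * Real.sinh c / (‖v‖ * c) * inner ℝ v X := by
  have hc : 0 ≤ c := (norm_nonneg X).trans hX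
  rcases hc.eq_or_lt with rfl | hc
  · have : X = 0 := by simpa using hX
    simp [this]
  rcases (norm_nonneg v).eq_or_lt with hv | hv
  · have hv0 : v = 0 := by simpa using hv.symm
    subst hv0
    have : Real.cosh ‖X‖ ≤ Real.cosh c :=
      Real.cosh_le_cosh.2 (by simpa [abs_of_pos hc] using hX)
    simpa using this
  have hin := abs_le.1 ((abs_real_inner_le_norm v X).trans
    (mul_le_mul_of_nonneg_left hX (norm_nonneg v)))
  have hpos : 0 < ‖v‖ * c := mul_pos hv hc
  set s : ℝ := inner ℝ v X / (‖v‖ * c) with hs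
  have hs' : inner ℝ v X = s * (‖v‖ * c) := by rw [hs]; field_simp
  have hs1 : s ≤ 1 := (div_le_one hpos).2 hin.2
  have hs2 : -1 ≤ s := (le_div_iff₀ hpos).2 (by linarith [hin.1])
  -- The bound ‖v‖² + 2⟨v, X⟩ + c² on ‖v + X‖² is the convex combination of (‖v‖ - c)² and (‖v‖ +
  -- c)² with weight (1 + s)/2.
  have key := Real.cosh_le_of_sq_le_convexComb (x := ‖v‖ - c) (y := ‖v‖ + c) (z := ‖v + X‖)
    (θ := (1 + s) / 2) (by linarith) (by linarith) (by
      rw [norm_add_sq_real, hs']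
      have := pow_le_pow_left₀ (norm_nonneg X) hX 2
      nlinarith)
  rw [Real.cosh_sub, Real.cosh_add] at key
  refine key.trans (le_of_eq ?_)
  rw [hs']
  field_simp
  ring

theorem Fin.sum_fun_succ {α V : Type*} [Fintype α] [AddCommMonoid V] {n : ℕ}
    (f : (Fin (n + 1) → α) → V) : ∑ x, f x = ∑ y : Fin n → α, ∑ a, f (Fin.cons a y) := by
  rw [← (Fin.consEquiv fun _ => α).sum_comp, Fintype.sum_prod_type_right]
  rfl

/-- Induction by averaging out the first coordinate: the average G keeps the mean and the remaining
bounded differences, while F - G has mean zero and norm at most `c 0`, which costs a factor cosh (`c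
0`) ≤ exp (`c 0`² / 2). -/
theorem sum_cosh_norm_le_fin {α : Type*} [Fintype α] [Nonempty α] (n : ℕ) (F : (Fin n → α) → E)
    (c : Fin n → ℝ) (hF : ∀ i x a, ‖F (Function.update x i a) - F x‖ ≤ c i) (e : E)
    (he : ∑ x, (F x - e) = 0) :
    ∑ x, Real.cosh ‖F x - e‖ ≤ Fintype.card (Fin n → α) * Real.exp ((∑ i, c i ^ 2) / 2) := by
  induction n with
  | zero =>
    have : F default - e = 0 := by simpa using he
    rw [Fintype.sum_unique, this]
    simp
  | succ n ih =>
    have hα : (0 : ℝ) < Fintype.card α := by exact_mod_cast Fintype.card_pos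
    set G : (Fin n → α) → E := fun y => (Fintype.card α : ℝ)⁻¹ • ∑ a, F (Fin.cons a y) with hG
    have hG' : ∀ y, ∑ a, (F (Fin.cons a y) - G y) = 0 := by
      intro y
      rw [Finset.sum_sub_distrib, Finset.sum_const, Finset.card_univ, ← Nat.cast_smul_eq_nsmul ℝ,
        hG, smul_smul, mul_inv_cancel₀ hα.ne', one_smul, sub_self]
    have avg : ∀ (f : α → E) (b : ℝ), (∀ a, ‖f a‖ ≤ b) →
        ‖(Fintype.card α : ℝ)⁻¹ • ∑ a, f a‖ ≤ b := by
      intro f b hf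
      rw [norm_smul, Real.norm_of_nonneg (by positivity), inv_mul_le_iff₀ hα]
      refine (norm_sum_le _ _).trans ((Finset.sum_le_sum fun a _ => hf a).trans ?_)
      simp
    have hdiff : ∀ a y, ‖F (Fin.cons a y) - G y‖ ≤ c 0 := by
      intro a y
      have : F (Fin.cons a y) - G y =
          (Fintype.card α : ℝ)⁻¹ • ∑ b, (F (Fin.cons a y) - F (Fin.cons b y)) := by
        rw [Finset.sum_sub_distrib, Finset.sum_const, Finset.card_univ,
          ← Nat.cast_smul_eq_nsmul ℝ, smul_sub, smul_smul, inv_mul_cancel₀ hα.ne', one_smul]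
      rw [this]
      refine avg _ _ fun b => ?_
      simpa using hF 0 (Fin.cons b y) a
    have hstep : ∀ y, ∑ a, Real.cosh ‖F (Fin.cons a y) - e‖ ≤
        Fintype.card α * (Real.cosh ‖G y - e‖ * Real.cosh (c 0)) := by
      intro y
      calc ∑ a, Real.cosh ‖F (Fin.cons a y) - e‖
          ≤ ∑ a, (Real.cosh ‖G y - e‖ * Real.cosh (c 0) +
            Real.sinh ‖G y - e‖ * Real.sinh (c 0) / (‖G y - e‖ * c 0) *
              inner ℝ (G y - e) (F (Fin.cons a y) - G y)) := by
            refine Finset.sum_le_sum fun a _ => ?_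
            have := cosh_norm_add_le (G y - e) (F (Fin.cons a y) - G y) (hdiff a y)
            rwa [show G y - e + (F (Fin.cons a y) - G y) = F (Fin.cons a y) - e by abel] at this
        _ = _ := by
            have h0 : ∑ a, inner ℝ (G y - e) (F (Fin.cons a y) - G y) = (0 : ℝ) := by
              rw [← inner_sum, hG' y, inner_zero_right]
            rw [Finset.sum_add_distrib, ← Finset.mul_sum _ _ (_ / _), h0]
            simp
    have hGe : ∑ y, (G y - e) = 0 := by
      have h1 : ∀ y, G y - e = (Fintype.card α : ℝ)⁻¹ • ∑ a, (F (Fin.cons a y) - e) := by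
        intro y
        rw [Finset.sum_sub_distrib, Finset.sum_const, Finset.card_univ,
          ← Nat.cast_smul_eq_nsmul ℝ, smul_sub, smul_smul, inv_mul_cancel₀ hα.ne', one_smul]
      rw [Finset.sum_congr rfl fun y _ => h1 y, ← Finset.smul_sum, ← Fin.sum_fun_succ fun x => F x - e, he,
        smul_zero]
    have hGF : ∀ i y a, ‖G (Function.update y i a) - G y‖ ≤ c i.succ := by
      intro i y a
      rw [hG]
      simp only
      rw [← smul_sub, ← Finset.sum_sub_distrib]
      refine avg _ _ fun b => ?_
      rw [Fin.cons_update]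
      exact hF _ _ _
    have hind := ih G (fun i => c i.succ) hGF hGe
    rw [Fin.sum_fun_succ]
    calc ∑ y, ∑ a, Real.cosh ‖F (Fin.cons a y) - e‖
        ≤ ∑ y, Fintype.card α * (Real.cosh ‖G y - e‖ * Real.cosh (c 0)) :=
          Finset.sum_le_sum fun y _ => hstep y
      _ = Fintype.card α * ((∑ y, Real.cosh ‖G y - e‖) * Real.cosh (c 0)) := by
          rw [Finset.sum_mul, Finset.mul_sum]
      _ ≤ Fintype.card α * ((Fintype.card (Fin n → α) * Real.exp ((∑ i : Fin n, c i.succ ^ 2) / 2)) *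
            Real.exp (c 0 ^ 2 / 2)) := by
          gcongr
          exact Real.cosh_le_exp_half_sq _
      _ = _ := by
          rw [Fin.sum_univ_succ, add_div, Real.exp_add]
          simp only [Fintype.card_pi, Finset.prod_const, Finset.card_univ, Fintype.card_fin,
            Nat.cast_pow]
          ring

theorem sum_cosh_norm_le {ι α : Type*} [Fintype ι] [DecidableEq ι] [Fintype α] [Nonempty α]
    (F : (ι → α) → E) (c : ι → ℝ) (hF : ∀ i x a, ‖F (Function.update x i a) - F x‖ ≤ c i) (e : E)
    (he : ∑ x, (F x - e) = 0) :
    ∑ x, Real.cosh ‖F x - e‖ ≤ Fintype.card (ι → α) * Real.exp ((∑ i, c i ^ 2) / 2) := by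
  set n := Fintype.card ι
  let φ : Fin n ≃ ι := (Fintype.equivFin ι).symm
  let Φ : (Fin n → α) ≃ (ι → α) := Equiv.arrowCongr φ (Equiv.refl α)
  have hΦ : ∀ x i a, Φ (Function.update x i a) = Function.update (Φ x) (φ i) a := by
    intro x i a
    ext j
    simp only [Φ, Equiv.arrowCongr_apply, Equiv.coe_refl, Function.comp_apply, id_eq,
      Function.update_apply, Equiv.symm_apply_eq]
  have := sum_cosh_norm_le_fin n (fun x => F (Φ x)) (fun i => c (φ i))
    (fun i x a => by simp only [hΦ]; exact hF _ _ _) e (by rwa [Φ.sum_comp fun x => F x - e])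
  rw [Φ.sum_comp fun x => Real.cosh ‖F x - e‖, φ.sum_comp fun i => c i ^ 2,
    Fintype.card_congr Φ] at this
  exact this

theorem card_norm_sub_ge_le {ι α : Type*} [Fintype ι] [DecidableEq ι] [Fintype α] [Nonempty α]
    (F : (ι → α) → E) (c : ι → ℝ) (hF : ∀ i x a, ‖F (Function.update x i a) - F x‖ ≤ c i) (e : E)
    (he : ∑ x, (F x - e) = 0) {V r : ℝ} (hV : 0 < V) (hc : ∑ i, c i ^ 2 ≤ V) (hr : 0 ≤ r) :
    (Nat.card {x // r ≤ ‖F x - e‖} : ℝ) ≤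
      2 * Real.exp (-(r ^ 2 / (2 * V))) * Fintype.card (ι → α) := by
  classical
  -- Chernoff's method: this value minimizes lam² V / 2 - lam r. The factor 2 in the tail comes from
  -- exp ≤ 2 cosh.
  set lam : ℝ := r / V with hlam
  have hl : 0 ≤ lam := by positivity
  have hs : ∀ x, ‖lam • F x - lam • e‖ = lam * ‖F x - e‖ := by
    intro x
    rw [← smul_sub, norm_smul, Real.norm_of_nonneg hl]
  have h1 := sum_cosh_norm_le (fun x => lam • F x) (fun i => lam * c i)
    (fun i x a => by
      rw [← smul_sub, norm_smul, Real.norm_of_nonneg hl]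
      exact mul_le_mul_of_nonneg_left (hF i x a) hl) (lam • e)
    (by simp only [← smul_sub, ← Finset.smul_sum, he, smul_zero])
  simp only [hs] at h1
  have h2 : (Nat.card {x // r ≤ ‖F x - e‖} : ℝ) * (Real.exp (lam * r) / 2) ≤
      ∑ x, Real.cosh (lam * ‖F x - e‖) := by
    rw [Nat.card_eq_fintype_card, Fintype.card_subtype, ← nsmul_eq_mul, ← Finset.sum_const]
    refine (Finset.sum_le_sum fun x hx => ?_).trans
      (Finset.sum_le_univ_sum_of_nonneg fun x => (Real.cosh_pos _).le)
    have hx' : r ≤ ‖F x - e‖ := (Finset.mem_filter.1 hx).2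
    have h3 : Real.cosh (lam * r) ≤ Real.cosh (lam * ‖F x - e‖) := by
      rw [Real.cosh_le_cosh, abs_of_nonneg (by positivity), abs_of_nonneg (by positivity)]
      gcongr
    refine le_trans ?_ h3
    rw [Real.cosh_eq]
    linarith [Real.exp_pos (-(lam * r))]
  have h4 : (∑ i, (lam * c i) ^ 2) / 2 ≤ lam ^ 2 * V / 2 := by
    simp only [mul_pow, ← Finset.mul_sum]
    gcongr
  have h5 := h2.trans (h1.trans (mul_le_mul_of_nonneg_left (Real.exp_le_exp.2 h4)
    (Nat.cast_nonneg _)))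
  have h6 : lam ^ 2 * V / 2 = -(r ^ 2 / (2 * V)) + lam * r := by
    rw [hlam]; field_simp; ring
  rw [h6, Real.exp_add] at h5
  have := Real.exp_pos (lam * r)
  refine le_of_mul_le_mul_right ?_ this
  linarith

end Concentration

namespace DistributedSysId

/-! ### Spectral and Frobenius norms -/

section Norms

variable {m n : Type*} [Fintype m] [Fintype n]

theorem norm_mulVec_le [DecidableEq n] (M : Matrix m n ℝ) (v : n → ℝ) :
    ‖WithLp.toLp 2 (M *ᵥ v)‖ ≤ ‖M‖ * ‖WithLp.toLp 2 v‖ :=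
  Matrix.l2_opNorm_mulVec M (WithLp.toLp 2 v)

theorem opNorm_le_of_mulVec_le [DecidableEq n] {M : Matrix m n ℝ} {c : ℝ} (hc : 0 ≤ c)
    (h : ∀ v : n → ℝ, ‖WithLp.toLp 2 (M *ᵥ v)‖ ≤ c * ‖WithLp.toLp 2 v‖) : ‖M‖ ≤ c := by
  rw [Matrix.l2_opNorm_def]
  exact ContinuousLinearMap.opNorm_le_bound _ hc fun x => h x.ofLp

theorem opNorm_transpose [DecidableEq m] [DecidableEq n] (M : Matrix m n ℝ) : ‖Mᵀ‖ = ‖M‖ := by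
  rw [← Matrix.conjTranspose_eq_transpose_of_trivial, Matrix.l2_opNorm_conjTranspose]

theorem opNorm_self_mul_transpose [DecidableEq m] [DecidableEq n] (M : Matrix m n ℝ) : ‖M * Mᵀ‖ = ‖M‖ ^ 2 := by
  have := Matrix.l2_opNorm_conjTranspose_mul_self Mᵀ
  rwa [Matrix.conjTranspose_eq_transpose_of_trivial, Matrix.transpose_transpose,
    opNorm_transpose, ← sq] at this

/-- A matrix as a vector of its entries; the Euclidean norm is the Frobenius norm. -/
def frobVec : Matrix m n ℝ →ₗ[ℝ] EuclideanSpace ℝ (m × n) where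
  toFun M := WithLp.toLp 2 fun p => M p.1 p.2
  map_add' _ _ := rfl
  map_smul' _ _ := rfl

theorem norm_frobVec_sq (M : Matrix m n ℝ) :
    ‖frobVec M‖ ^ 2 = ∑ a, ‖WithLp.toLp 2 (M a)‖ ^ 2 := by
  simp only [EuclideanSpace.norm_sq_eq, Fintype.sum_prod_type]
  rfl

theorem opNorm_le_frobVec [DecidableEq n] (M : Matrix m n ℝ) : ‖M‖ ≤ ‖frobVec M‖ := by
  refine opNorm_le_of_mulVec_le (norm_nonneg _) fun v => ?_
  refine le_of_sq_le_sq ?_ (by positivity)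
  rw [mul_pow, norm_frobVec_sq, EuclideanSpace.norm_sq_eq, Finset.sum_mul]
  refine Finset.sum_le_sum fun a _ => ?_
  rw [Real.norm_eq_abs, ← mul_pow]
  refine pow_le_pow_left₀ (abs_nonneg _) ?_ 2
  have := abs_real_inner_le_norm (WithLp.toLp 2 v) (WithLp.toLp 2 (M a))
  rw [EuclideanSpace.inner_toLp_toLp, mul_comm] at this
  simpa [Matrix.mulVec] using this

theorem norm_frobVec_vecMulVec (u : m → ℝ) (v : n → ℝ) :
    ‖frobVec (Matrix.vecMulVec u v)‖ = ‖WithLp.toLp 2 u‖ * ‖WithLp.toLp 2 v‖ := by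
  rw [← sq_eq_sq₀ (norm_nonneg _) (by positivity), mul_pow]
  simp only [EuclideanSpace.norm_sq_eq, Fintype.sum_prod_type, Finset.sum_mul_sum]
  refine Finset.sum_congr rfl fun a _ => Finset.sum_congr rfl fun b _ => ?_
  rw [← mul_pow, ← norm_mul]
  rfl

theorem norm_frobVec_blockRow_le {d₁ d₂ q : ℕ} {N : ℕ → Matrix (Fin d₁) (Fin d₂) ℝ} {ε : ℝ}
    (hε : 0 ≤ ε) (hN : ∀ l < q, ‖frobVec (N l)‖ ≤ ε) :
    ‖frobVec (blockRow q N)‖ ≤ Real.sqrt q * ε := by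
  refine le_of_sq_le_sq ?_ (by positivity)
  have h : ‖frobVec (blockRow q N)‖ ^ 2 = ∑ l : Fin q, ‖frobVec (N l)‖ ^ 2 := by
    simp only [EuclideanSpace.norm_sq_eq, Fintype.sum_prod_type]
    rw [Finset.sum_comm]
    rfl
  rw [h, mul_pow, Real.sq_sqrt (Nat.cast_nonneg q)]
  refine (Finset.sum_le_sum fun (l : Fin q) _ =>
    pow_le_pow_left₀ (norm_nonneg _) (hN l l.2) 2).trans ?_
  simp

end Norms

/-! ### Perturbation of the least squares problem -/

/-- The smallest singular value of C is at least 1/√κ, and the perturbation removes at most half of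
it. -/
theorem transpose_mul_inv_bound_of_close {m n : Type*} [Fintype m] [Fintype n] [DecidableEq m]
    [DecidableEq n] {C C' : Matrix m n ℝ} {κ : ℝ} (hκ : 0 < κ)
    (hu : IsUnit (C * Cᵀ)) (hC : ‖(C * Cᵀ)⁻¹‖ ≤ κ) (hclose : ‖C' - C‖ ≤ 1 / (2 * Real.sqrt κ)) :
    IsUnit (C' * C'ᵀ) ∧ ‖C'ᵀ * (C' * C'ᵀ)⁻¹‖ ≤ 2 * Real.sqrt κ := by
  have hs : 0 < Real.sqrt κ := Real.sqrt_pos.2 hκ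
  have hsymm : ∀ D : Matrix m n ℝ, ((D * Dᵀ)⁻¹)ᵀ = (D * Dᵀ)⁻¹ := fun D => by
    rw [Matrix.transpose_nonsing_inv, Matrix.transpose_mul, Matrix.transpose_transpose]
  -- With G = (D Dᵀ)⁻¹ one has (G D)(G D)ᵀ = G, so the C*-identity applies.
  have hsq : ∀ D : Matrix m n ℝ, IsUnit (D * Dᵀ) → ‖(D * Dᵀ)⁻¹ * D‖ ^ 2 = ‖(D * Dᵀ)⁻¹‖ := by
    intro D hD
    rw [← opNorm_self_mul_transpose, Matrix.transpose_mul, hsymm, Matrix.mul_assoc,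
      ← Matrix.mul_assoc D, Matrix.mul_nonsing_inv _ ((Matrix.isUnit_iff_isUnit_det _).1 hD),
      Matrix.mul_one]
  have hR : ‖(C * Cᵀ)⁻¹ * C‖ ≤ Real.sqrt κ :=
    Real.le_sqrt_of_sq_le ((hsq C hu).le.trans hC)
  have hlow : ∀ y : m → ℝ,
      ‖WithLp.toLp 2 y‖ ≤ 2 * Real.sqrt κ * ‖WithLp.toLp 2 (C'ᵀ *ᵥ y)‖ := by
    intro y
    have h1 : ‖WithLp.toLp 2 y‖ ≤ Real.sqrt κ * ‖WithLp.toLp 2 (Cᵀ *ᵥ y)‖ := by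
      have : y = ((C * Cᵀ)⁻¹ * C) *ᵥ (Cᵀ *ᵥ y) := by
        rw [Matrix.mulVec_mulVec, Matrix.mul_assoc,
          Matrix.nonsing_inv_mul _ ((Matrix.isUnit_iff_isUnit_det _).1 hu), Matrix.one_mulVec]
      calc ‖WithLp.toLp 2 y‖ = ‖WithLp.toLp 2 (((C * Cᵀ)⁻¹ * C) *ᵥ (Cᵀ *ᵥ y))‖ := by rw [← this]
        _ ≤ _ := (norm_mulVec_le _ _).trans (by gcongr)
    have h2 : ‖WithLp.toLp 2 (Cᵀ *ᵥ y)‖ ≤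
        ‖WithLp.toLp 2 (C'ᵀ *ᵥ y)‖ + 1 / (2 * Real.sqrt κ) * ‖WithLp.toLp 2 y‖ := by
      have : Cᵀ *ᵥ y = C'ᵀ *ᵥ y - (C' - C)ᵀ *ᵥ y := by
        rw [← Matrix.sub_mulVec, Matrix.transpose_sub, sub_sub_cancel]
      rw [this, WithLp.toLp_sub]
      refine (norm_sub_le _ _).trans (add_le_add le_rfl ((norm_mulVec_le _ _).trans ?_))
      rw [opNorm_transpose]
      gcongr
    have h3 := h1.trans (mul_le_mul_of_nonneg_left h2 hs.le)
    have h4 : Real.sqrt κ * (1 / (2 * Real.sqrt κ) * ‖WithLp.toLp 2 y‖) =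
        ‖WithLp.toLp 2 y‖ / 2 := by field_simp
    rw [mul_add, h4] at h3
    linarith
  have hu' : IsUnit (C' * C'ᵀ) := by
    rw [← Matrix.mulVec_injective_iff_isUnit]
    intro y z hyz
    have h0 : (C' * C'ᵀ) *ᵥ (y - z) = 0 := by
      rw [Matrix.mulVec_sub]; exact sub_eq_zero.2 hyz
    rw [← Matrix.conjTranspose_eq_transpose_of_trivial,
      Matrix.self_mul_conjTranspose_mulVec_eq_zero,
      Matrix.conjTranspose_eq_transpose_of_trivial] at h0
    have := hlow (y - z)
    rw [h0] at this
    have h1 : WithLp.toLp 2 (y - z) = 0 :=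
      norm_le_zero_iff.1 (by simpa only [WithLp.toLp_zero, norm_zero, mul_zero] using this)
    exact sub_eq_zero.1 (congrArg WithLp.ofLp h1)
  refine ⟨hu', ?_⟩
  have hD : ‖C'ᵀ * (C' * C'ᵀ)⁻¹‖ = ‖(C' * C'ᵀ)⁻¹ * C'‖ := by
    rw [← opNorm_transpose, Matrix.transpose_mul, hsymm, Matrix.transpose_transpose]
  have hG : ‖(C' * C'ᵀ)⁻¹‖ ≤ 2 * Real.sqrt κ * ‖C'ᵀ * (C' * C'ᵀ)⁻¹‖ := by
    refine opNorm_le_of_mulVec_le (by positivity) fun v => (hlow _).trans ?_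
    rw [Matrix.mulVec_mulVec, mul_assoc (2 * Real.sqrt κ)]
    exact mul_le_mul_of_nonneg_left (norm_mulVec_le _ _) (by positivity)
  -- By `hsq` the left-hand side of `hG` is the square of the norm to be bounded, so one factor
  -- cancels.
  rw [← hsq C' hu', hD, sq] at hG
  rw [hD]
  rcases (norm_nonneg ((C' * C'ᵀ)⁻¹ * C')).eq_or_lt with h | h
  · rw [← h]; positivity
  · exact le_of_mul_le_mul_right hG h

theorem StronglyStable.norm_pow_le {d₁ d₂ : ℕ} {A : Matrix (Fin d₁) (Fin d₁) ℝ}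
    {B : Matrix (Fin d₁) (Fin d₂) ℝ} {K : Matrix (Fin d₂) (Fin d₁) ℝ} {κ γ : ℝ}
    (h : StronglyStable A B K κ γ) (hd : 0 < d₁) (k : ℕ) :
    ‖(A - B * K) ^ k‖ ≤ κ ^ 2 * (1 - γ) ^ k := by
  obtain ⟨hκ, hγ, hγ1, -, L, H, hH, hA, hL, hHn, hHi⟩ := h
  have hdet := (Matrix.isUnit_iff_isUnit_det _).1 hH
  -- Nonemptiness gives ‖1‖ = 1, needed for the power k = 0.
  have : Nonempty (Fin d₁) := ⟨⟨0, hd⟩⟩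
  have hpow : (A - B * K) ^ k = H * L ^ k * H⁻¹ := by
    induction k with
    | zero => rw [pow_zero, pow_zero, mul_one, Matrix.mul_nonsing_inv _ hdet]
    | succ k ih =>
      rw [pow_succ, ih, hA, pow_succ]
      simp only [Matrix.mul_assoc]
      rw [← Matrix.mul_assoc H⁻¹ H, Matrix.nonsing_inv_mul _ hdet, Matrix.one_mul]
  have hLk : ‖L ^ k‖ ≤ (1 - γ) ^ k :=
    (_root_.norm_pow_le L k).trans (pow_le_pow_left₀ (norm_nonneg _) hL k)
  rw [hpow]
  calc ‖H * L ^ k * H⁻¹‖ ≤ ‖H‖ * ‖L ^ k‖ * ‖H⁻¹‖ :=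
        (norm_mul_le _ _).trans (by gcongr; exact norm_mul_le _ _)
    _ ≤ κ * (1 - γ) ^ k * κ := by gcongr
    _ = _ := by ring

/-- With exact moments the response is Ac times the regressor. In general the right inverse of C₀
reproduces Ac from Ac C₀, so the error of Â is the residual C₁ - Ac C₀ times that right inverse,
plus the error of B̂ times K. -/
theorem estimates_of_moments_close {d₁ d₂ q : ℕ} {A : Matrix (Fin d₁) (Fin d₁) ℝ}
    {B : Matrix (Fin d₁) (Fin d₂) ℝ} {K : Matrix (Fin d₂) (Fin d₁) ℝ} {κ γ ε : ℝ}
    (hd : 0 < d₁) (hκ : 1 ≤ κ) (hst : StronglyStable A B K κ γ)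
    (hco : StronglyControllable (A - B * K) B q κ) (hε : 0 ≤ ε)
    {N : ℕ → Matrix (Fin d₁) (Fin d₂) ℝ}
    (hN : ∀ l ≤ q, ‖frobVec (N l - (A - B * K) ^ l * B)‖ ≤ ε)
    (hsmall : Real.sqrt q * ε ≤ 1 / (2 * Real.sqrt κ)) :
    IsUnit (regressor q N * (regressor q N)ᵀ) ∧
      ‖estimateA q K N - A‖ ≤ 5 * Real.sqrt κ * κ ^ 2 * (Real.sqrt q * ε) ∧
      ‖estimateB N - B‖ ≤ ε := by
  set Ac := A - B * K with hAc
  have hB : ‖estimateB N - B‖ ≤ ε := by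
    have := hN 0 (Nat.zero_le _)
    rw [pow_zero, Matrix.one_mul] at this
    exact (opNorm_le_frobVec _).trans this
  have hAcn : ‖Ac‖ ≤ κ ^ 2 := by
    have h1 := hst.norm_pow_le hd 1
    rw [pow_one, pow_one] at h1
    obtain ⟨-, hγ, -⟩ := hst
    nlinarith [sq_nonneg κ]
  have hK : ‖K‖ ≤ κ := hst.2.2.2.1
  obtain ⟨hq, hu, hi⟩ := hco
  have h0 : ‖regressor q N - controllabilityMatrix Ac B q‖ ≤ Real.sqrt q * ε := by
    have : regressor q N - controllabilityMatrix Ac B q = blockRow q fun l => N l - Ac ^ l * B :=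
      rfl
    rw [this]
    exact (opNorm_le_frobVec _).trans (norm_frobVec_blockRow_le hε fun l hl => hN l hl.le)
  have h1 : ‖response q N - Ac * controllabilityMatrix Ac B q‖ ≤ Real.sqrt q * ε := by
    have : response q N - Ac * controllabilityMatrix Ac B q =
        blockRow q fun l => N (l + 1) - Ac ^ (l + 1) * B := by
      have h2 : Ac * controllabilityMatrix Ac B q = blockRow q fun l => Ac ^ (l + 1) * B := by
        ext a p
        simp only [pow_succ', Matrix.mul_assoc]
        rfl
      rw [h2]; rfl
    rw [this]
    exact (opNorm_le_frobVec _).trans (norm_frobVec_blockRow_le hε fun l hl => hN _ hl)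
  obtain ⟨hu', hb⟩ := transpose_mul_inv_bound_of_close (by linarith) hu hi (h0.trans hsmall)
  refine ⟨hu', ?_, hB⟩
  set C₀ := regressor q N
  set C₁ := response q N
  set C := controllabilityMatrix Ac B q
  have hid : estimateA q K N - A =
      ((C₁ - Ac * C) - Ac * (C₀ - C)) * (C₀ᵀ * (C₀ * C₀ᵀ)⁻¹) + (estimateB N - B) * K := by
    have hA : A = Ac * (C₀ * (C₀ᵀ * (C₀ * C₀ᵀ)⁻¹)) + B * K := by
      rw [← Matrix.mul_assoc C₀, Matrix.mul_nonsing_inv _ ((Matrix.isUnit_iff_isUnit_det _).1 hu'),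
        Matrix.mul_one, hAc, sub_add_cancel]
    have h3 : C₁ - Ac * C - Ac * (C₀ - C) = C₁ - Ac * C₀ := by
      rw [Matrix.mul_sub]; abel
    rw [h3, Matrix.sub_mul C₁, Matrix.sub_mul (estimateB N), Matrix.mul_assoc Ac, eq_sub_of_add_eq hA.symm, estimateA,
      Matrix.mul_assoc (response q N)]
    abel
  have hq1 : (1 : ℝ) ≤ Real.sqrt q := Real.one_le_sqrt.2 (by exact_mod_cast hq)
  have hk1 : (1 : ℝ) ≤ Real.sqrt κ := Real.one_le_sqrt.2 hκ
  set η := Real.sqrt q * ε with hη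
  have hη0 : 0 ≤ η := by positivity
  have hεη : ε ≤ η := le_mul_of_one_le_left hε hq1
  rw [hid]
  calc _ ≤ (‖C₁ - Ac * C‖ + ‖Ac‖ * ‖C₀ - C‖) * ‖C₀ᵀ * (C₀ * C₀ᵀ)⁻¹‖ + ‖estimateB N - B‖ * ‖K‖ := by
        refine (norm_add_le _ _).trans (add_le_add ((Matrix.l2_opNorm_mul _ _).trans ?_)
          (Matrix.l2_opNorm_mul _ _))
        gcongr
        refine (norm_sub_le _ _).trans (add_le_add le_rfl (Matrix.l2_opNorm_mul _ _))
    _ ≤ (η + κ ^ 2 * η) * (2 * Real.sqrt κ) + η * κ := by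
        gcongr
        exact hB.trans hεη
    _ ≤ _ := by
        have e1 : κ ≤ κ ^ 2 := by nlinarith
        have e2 : η * κ ≤ η * (Real.sqrt κ * κ ^ 2) :=
          mul_le_mul_of_nonneg_left (by nlinarith) hη0
        have e3 : (1 : ℝ) ≤ κ ^ 2 := by nlinarith
        have e4 : η * Real.sqrt κ ≤ η * Real.sqrt κ * κ ^ 2 :=
          le_mul_of_one_le_right (by positivity) e3
        nlinarith

end DistributedSysId

/-! ### Consensus averaging -/

/-- A Courant–Fischer argument on the span of e and v. The top eigenvector of T*T supplied by the
eigenbasis need not be a multiple of e, as the top singular value may be repeated, so the bound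
cannot be read off from v ⊥ e directly. -/
theorem LinearMap.norm_map_le_singularValues_one {E : Type*} [NormedAddCommGroup E]
    [InnerProductSpace ℝ E] [FiniteDimensional ℝ E] (T : E →ₗ[ℝ] E) {e v : E} (he0 : e ≠ 0)
    (hT : ∀ x, ‖T x‖ ≤ ‖x‖) (he : T e = e) (hev : inner ℝ e v = 0)
    (heTv : inner ℝ e (T v) = 0) : ‖T v‖ ≤ T.singularValues 1 * ‖v‖ := by
  rcases Nat.lt_or_ge 1 (Module.finrank ℝ E) with hn | hn
  swap
  · obtain ⟨c, rfl⟩ := exists_smul_eq_of_finrank_eq_one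
      (le_antisymm hn (Module.finrank_pos_iff_exists_ne_zero.2 ⟨e, he0⟩)) he0 v
    have : c = 0 := by simpa [inner_smul_right, he0] using hev
    simp [this]
  set n := Module.finrank ℝ E with hnE
  have hS := T.isSymmetric_adjoint_comp_self
  set b := hS.eigenvectorBasis hnE.symm with hb
  set lam := hS.eigenvalues hnE.symm with hlam
  set i₀ : Fin n := ⟨0, by omega⟩
  set i₁ : Fin n := ⟨1, hn⟩
  have hsv : T.singularValues 1 ^ 2 = lam i₁ := T.sq_singularValues_of_lt hnE.symm hn
  have hexp : ∀ u, ‖T u‖ ^ 2 = ∑ i, lam i * b.repr u i ^ 2 := by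
    intro u
    have h1 : ‖T u‖ ^ 2 = inner ℝ u ((LinearMap.adjoint T ∘ₗ T) u) := by
      rw [LinearMap.comp_apply, LinearMap.adjoint_inner_right, real_inner_self_eq_norm_sq]
    rw [h1, ← b.repr.inner_map_map, PiLp.inner_apply]
    refine Finset.sum_congr rfl fun i _ => ?_
    rw [hS.eigenvectorBasis_apply_self_apply hnE.symm u i]
    simp only [RCLike.inner_apply, conj_trivial, RCLike.ofReal_real_eq_id, id_eq]
    ring
  have hray : ∀ u, inner ℝ (b i₀) u = 0 → ‖T u‖ ^ 2 ≤ lam i₁ * ‖u‖ ^ 2 := by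
    intro u hu
    rw [hexp, ← b.repr.norm_map u, EuclideanSpace.norm_sq_eq, Finset.mul_sum]
    refine Finset.sum_le_sum fun i _ => ?_
    rw [Real.norm_eq_abs, sq_abs]
    rcases eq_or_ne i i₀ with rfl | hi
    · rw [b.repr_apply_apply, hu]; simp
    · refine mul_le_mul_of_nonneg_right (hS.eigenvalues_antitone hnE.symm ?_) (sq_nonneg _)
      rw [Fin.le_def]
      have : (i : ℕ) ≠ 0 := fun h => hi (Fin.ext h)
      change 1 ≤ (i : ℕ)
      omega
  have hlam1 : lam i₁ ≤ 1 := by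
    have h1 : ‖T (b i₁)‖ ^ 2 = lam i₁ := by
      rw [hexp]
      simp [b.repr_self]
    rw [← h1]
    have := hT (b i₁)
    rw [b.norm_eq_one] at this
    exact pow_le_one₀ (norm_nonneg _) this
  refine le_of_sq_le_sq ?_ (mul_nonneg (T.singularValues_nonneg 1) (norm_nonneg v))
  rw [mul_pow, hsv]
  have hepos : 0 < ‖e‖ ^ 2 := by positivity
  -- If e is orthogonal to the top eigenvector, the Rayleigh bound at e forces σ₁ ≥ 1 and
  -- contractivity is enough. Otherwise α e - β v is orthogonal to it, Pythagoras separates the e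
  -- and v parts, and λ₁ ≤ 1 absorbs the e part.
  by_cases h0 : inner ℝ (b i₀) e = 0
  · have h1 := hray e h0
    rw [he] at h1
    have h2 : 1 ≤ lam i₁ := by
      by_contra h
      nlinarith
    calc ‖T v‖ ^ 2 ≤ ‖v‖ ^ 2 := pow_le_pow_left₀ (norm_nonneg _) (hT v) 2
      _ ≤ _ := le_mul_of_one_le_left (sq_nonneg _) h2
  · set α : ℝ := inner ℝ (b i₀) v
    set β : ℝ := inner ℝ (b i₀) e
    have h1 := hray (α • e - β • v) (by
      rw [inner_sub_right, inner_smul_right, inner_smul_right]; ring)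
    have pyth : ∀ y : E, inner ℝ e y = 0 →
        ‖α • e - β • y‖ ^ 2 = α ^ 2 * ‖e‖ ^ 2 + β ^ 2 * ‖y‖ ^ 2 := by
      intro y hy
      rw [norm_sub_sq_real, inner_smul_left, inner_smul_right, hy, norm_smul, norm_smul, mul_pow,
        mul_pow]
      simp
    rw [map_sub, map_smul, map_smul, he, pyth _ hev, pyth _ heTv] at h1
    have hβ : 0 < β ^ 2 := by positivity
    refine le_of_mul_le_mul_left ?_ hβ
    nlinarith [mul_nonneg (mul_nonneg (sq_nonneg α) hepos.le) (sub_nonneg.2 hlam1)]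

namespace DistributedSysId

section Consensus

variable {m : ℕ} {P : Matrix (Fin m) (Fin m) ℝ}

theorem IsNetworkMatrix.norm_mulVec_le (hP : IsNetworkMatrix P) (hm : 0 < m) {v : Fin m → ℝ}
    (hv : ∑ j, v j = 0) :
    ‖WithLp.toLp 2 (P *ᵥ v)‖ ≤ secondSingularValue P * ‖WithLp.toLp 2 v‖ := by
  have hone : ∀ y : Fin m → ℝ, inner ℝ (WithLp.toLp 2 (1 : Fin m → ℝ)) (WithLp.toLp 2 y) =
      ∑ j, y j := by
    intro y
    rw [EuclideanSpace.inner_toLp_toLp]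
    simp [dotProduct]
  refine LinearMap.norm_map_le_singularValues_one (Matrix.toEuclideanLin P)
    (e := WithLp.toLp 2 1) (v := WithLp.toLp 2 v) ?_ ?_ ?_ ?_ ?_
  · intro h
    have := congrFun (congrArg WithLp.ofLp h) ⟨0, hm⟩
    simp at this
  · intro x
    refine (DistributedSysId.norm_mulVec_le P x.ofLp).trans ?_
    exact mul_le_of_le_one_left (norm_nonneg _)
      (Matrix.l2_opNorm_le_one_of_mem_doublyStochastic hP.doublyStochastic)
  · exact congrArg (WithLp.toLp 2) (mulVec_one_of_mem_doublyStochastic hP.doublyStochastic)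
  · rw [hone, hv]
  · have := sum_mulVec_of_mem_doublyStochastic hP.doublyStochastic (x := v)
    exact (hone _).trans (this.trans hv)

theorem IsNetworkMatrix.norm_pow_mulVec_le (hP : IsNetworkMatrix P) (hm : 0 < m) {v : Fin m → ℝ}
    (hv : ∑ j, v j = 0) (s : ℕ) :
    ∑ j, ((P ^ s) *ᵥ v) j = 0 ∧
      ‖WithLp.toLp 2 ((P ^ s) *ᵥ v)‖ ≤ secondSingularValue P ^ s * ‖WithLp.toLp 2 v‖ := by
  induction s with
  | zero => simp [hv]
  | succ s ih =>
    rw [pow_succ', ← Matrix.mulVec_mulVec]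
    refine ⟨(sum_mulVec_of_mem_doublyStochastic hP.doublyStochastic).trans ih.1, ?_⟩
    refine (hP.norm_mulVec_le hm ih.1).trans ?_
    rw [pow_succ', mul_assoc]
    exact mul_le_mul_of_nonneg_left ih.2 (LinearMap.singularValues_nonneg _ _)

theorem exchange_eq_sum_pow {d₁ d₂ : ℕ} (N : Fin m → Matrix (Fin d₁) (Fin d₂) ℝ) (s : ℕ)
    (i : Fin m) : exchange P N s i = ∑ j, (P ^ s) j i • N j := by
  induction s generalizing i with
  | zero => simp [exchange, Matrix.one_apply]
  | succ s ih =>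
    simp only [exchange, ih, Finset.smul_sum, smul_smul]
    rw [Finset.sum_comm]
    refine Finset.sum_congr rfl fun j _ => ?_
    rw [← Finset.sum_smul, pow_succ, Matrix.mul_apply]
    simp only [mul_comm]

/-- The deviation is a combination of the N_j with coefficient vector P^s (e_i - 1/m). This vector
starts with mean zero and norm at most 1, so s rounds shrink it by β^s; passing from the ℓ² to the
ℓ¹ norm costs √m. -/
theorem IsNetworkMatrix.norm_exchange_sub_mean_le {d₁ d₂ : ℕ} (hP : IsNetworkMatrix P)
    (hm : 0 < m) {N : Fin m → Matrix (Fin d₁) (Fin d₂) ℝ} {R : ℝ}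
    (hN : ∀ j, ‖frobVec (N j)‖ ≤ R) (s : ℕ) (i : Fin m) :
    ‖frobVec (exchange P N s i - (m : ℝ)⁻¹ • ∑ j, N j)‖ ≤
      Real.sqrt m * secondSingularValue P ^ s * R := by
  have hm' : (0 : ℝ) < m := by exact_mod_cast hm
  have hR : 0 ≤ R := (norm_nonneg _).trans (hN i)
  set v : Fin m → ℝ := Pi.single i 1 - (m : ℝ)⁻¹ • 1 with hv
  have hv0 : ∑ j, v j = 0 := by
    simp [hv, Finset.sum_sub_distrib, hm'.ne']
  have hv1 : ‖WithLp.toLp 2 v‖ ≤ 1 := by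
    refine le_of_sq_le_sq ?_ zero_le_one
    have h1 : ∀ j, v j ^ 2 = (1 - 2 * (m : ℝ)⁻¹) * (Pi.single i (1 : ℝ) : Fin m → ℝ) j +
        (m : ℝ)⁻¹ ^ 2 := by
      intro j
      simp only [hv, Pi.sub_apply, Pi.smul_apply, Pi.one_apply, smul_eq_mul, Pi.single_apply]
      split_ifs <;> ring
    rw [EuclideanSpace.real_norm_sq_eq]
    simp only [h1, Finset.sum_add_distrib, ← Finset.mul_sum]
    simp only [Finset.sum_pi_single', Finset.mem_univ, if_true, Finset.sum_const,
      Finset.card_univ, Fintype.card_fin, nsmul_eq_mul]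
    have : (m : ℝ) * (m : ℝ)⁻¹ ^ 2 = (m : ℝ)⁻¹ := by field_simp
    rw [this]
    have := inv_pos.2 hm'
    linarith
  obtain ⟨-, hb⟩ := hP.norm_pow_mulVec_le hm hv0 s
  set u := (P ^ s) *ᵥ v with hu
  have hPs : P ^ s ∈ _root_.doublyStochastic ℝ (Fin m) := pow_mem hP.doublyStochastic s
  have hcoef : ∀ j, u j = (P ^ s) j i - (m : ℝ)⁻¹ := by
    intro j
    rw [hu, hv, Matrix.mulVec_sub, Matrix.mulVec_smul, mulVec_one_of_mem_doublyStochastic hPs]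
    simp
  have hrep : exchange P N s i - (m : ℝ)⁻¹ • ∑ j, N j = ∑ j, u j • N j := by
    rw [exchange_eq_sum_pow, Finset.smul_sum, ← Finset.sum_sub_distrib]
    exact Finset.sum_congr rfl fun j _ => by rw [hcoef, sub_smul]
  have hl1 : ∑ j, |u j| ≤ Real.sqrt m * ‖WithLp.toLp 2 u‖ := by
    refine le_of_sq_le_sq ?_ (by positivity)
    rw [mul_pow, Real.sq_sqrt hm'.le, EuclideanSpace.norm_sq_eq]
    have := sq_sum_le_card_mul_sum_sq (s := Finset.univ) (f := fun j => |u j|)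
    simpa using this
  rw [hrep, map_sum]
  calc ‖∑ j, frobVec (u j • N j)‖ ≤ ∑ j, |u j| * R := by
        refine norm_sum_le_of_le _ fun j _ => ?_
        rw [map_smul, norm_smul, Real.norm_eq_abs]
        exact mul_le_mul_of_nonneg_left (hN j) (abs_nonneg _)
    _ = (∑ j, |u j|) * R := by rw [Finset.sum_mul]
    _ ≤ _ := by
        refine mul_le_mul_of_nonneg_right (hl1.trans ?_) hR
        refine mul_le_mul_of_nonneg_left (hb.trans ?_) (Real.sqrt_nonneg _)
        exact mul_le_of_le_one_right (pow_nonneg (LinearMap.singularValues_nonneg _ _) _) hv1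

end Consensus

end DistributedSysId

namespace DistributedSysId

/-! ### Trajectories under the exploration control -/

section Dynamics

variable {d₁ d₂ : ℕ} {A : Matrix (Fin d₁) (Fin d₁) ℝ} {B : Matrix (Fin d₁) (Fin d₂) ℝ}
  {K : Matrix (Fin d₂) (Fin d₁) ℝ} {w : ℕ → Fin d₁ → ℝ} {κ γ W : ℝ}

theorem explorationState_succ (ξ : ℕ → Fin d₂ → ℝ) (t : ℕ) :
    explorationState A B K w ξ (t + 1) =
      ∑ k ∈ Finset.range t, (A - B * K) ^ k *ᵥ (B *ᵥ ξ (t - k) + w (t - k)) := by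
  induction t with
  | zero => simp [explorationState]
  | succ t ih =>
    have h : explorationState A B K w ξ (t + 1 + 1) =
        (A - B * K) *ᵥ explorationState A B K w ξ (t + 1) + (B *ᵥ ξ (t + 1) + w (t + 1)) := by
      simp only [explorationState, explorationControl, Matrix.mulVec_add, Matrix.mulVec_neg,
        Matrix.sub_mulVec, Matrix.mulVec_mulVec]
      abel
    rw [h, ih, Finset.sum_range_succ', Matrix.mulVec_sum]
    simp [Matrix.mulVec_mulVec, pow_succ']

theorem explorationState_congr {ξ ξ' : ℕ → Fin d₂ → ℝ} {t : ℕ} (h : ∀ s < t, ξ s = ξ' s) :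
    explorationState A B K w ξ t = explorationState A B K w ξ' t := by
  cases t with
  | zero => rfl
  | succ t =>
    rw [explorationState_succ, explorationState_succ]
    exact Finset.sum_congr rfl fun k _ => by rw [h (t - k) (by omega)]

theorem localMoment_congr {q Tc l : ℕ} (hl : l ≤ q) {ξ ξ' : ℕ → Fin d₂ → ℝ}
    (h : ∀ s < Tc, ξ s = ξ' s) :
    localMoment q Tc (explorationState A B K w ξ) ξ l =
      localMoment q Tc (explorationState A B K w ξ') ξ' l := by
  rw [localMoment, localMoment]
  congr 1
  refine Finset.sum_congr rfl fun t ht => ?_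
  rw [Finset.mem_Icc] at ht
  -- The latest state is at time t + l + 1 ≤ Tc, and it involves only signals before Tc.
  rw [h t (by omega), explorationState_congr fun s hs => h s (by omega)]

theorem sum_range_one_sub_pow_le (hγ : 0 < γ) (hγ1 : γ ≤ 1) (t : ℕ) :
    ∑ k ∈ Finset.range t, (1 - γ) ^ k ≤ 1 / γ := by
  rw [le_div_iff₀ hγ]
  have := geom_sum_mul_neg (1 - γ) t
  rw [sub_sub_cancel] at this
  rw [this]
  linarith [pow_nonneg (sub_nonneg.2 hγ1) t]

theorem norm_explorationState_le (hd₁ : 0 < d₁) (hd₂ : 0 < d₂) (hκ : 1 ≤ κ) (hW : 1 ≤ W)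
    (hB : ‖B‖ ≤ κ) (hw : ∀ t, ‖WithLp.toLp 2 (w t)‖ ≤ W) (hst : StronglyStable A B K κ γ)
    {ξ : ℕ → Fin d₂ → ℝ} (hξ : ∀ t, ‖WithLp.toLp 2 (ξ t)‖ ≤ Real.sqrt d₂) (t : ℕ) :
    ‖WithLp.toLp 2 (explorationState A B K w ξ t)‖ ≤ 2 * κ ^ 3 * Real.sqrt d₂ * W / γ := by
  have hγ := hst.2.1
  have hγ1 := hst.2.2.1
  have hd : 1 ≤ Real.sqrt d₂ := Real.one_le_sqrt.2 (by exact_mod_cast hd₂)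
  cases t with
  | zero =>
    have : explorationState A B K w ξ 0 = 0 := rfl
    rw [this, WithLp.toLp_zero, norm_zero]
    positivity
  | succ t =>
    rw [explorationState_succ, WithLp.toLp_sum]
    have hin : ∀ k, ‖WithLp.toLp 2 (B *ᵥ ξ (t - k) + w (t - k))‖ ≤ 2 * κ * Real.sqrt d₂ * W := by
      intro k
      rw [WithLp.toLp_add]
      refine (norm_add_le _ _).trans ?_
      have h1 : ‖WithLp.toLp 2 (B *ᵥ ξ (t - k))‖ ≤ κ * Real.sqrt d₂ :=
        (norm_mulVec_le _ _).trans (by gcongr; exact hξ _)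
      have h2 : κ * Real.sqrt d₂ ≤ κ * Real.sqrt d₂ * W :=
        le_mul_of_one_le_right (by positivity) hW
      have h3 : W ≤ κ * Real.sqrt d₂ * W :=
        le_mul_of_one_le_left (by positivity) (one_le_mul_of_one_le_of_one_le hκ hd)
      linarith [hw (t - k)]
    calc _ ≤ ∑ k ∈ Finset.range t, κ ^ 2 * (1 - γ) ^ k * (2 * κ * Real.sqrt d₂ * W) := by
          refine norm_sum_le_of_le _ fun k _ => (norm_mulVec_le _ _).trans ?_
          gcongr
          · exact hst.norm_pow_le hd₁ k
          · exact hin k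
      _ = κ ^ 2 * (2 * κ * Real.sqrt d₂ * W) * ∑ k ∈ Finset.range t, (1 - γ) ^ k := by
          rw [Finset.mul_sum]
          exact Finset.sum_congr rfl fun k _ => by ring
      _ ≤ κ ^ 2 * (2 * κ * Real.sqrt d₂ * W) * (1 / γ) := by
          gcongr
          exact sum_range_one_sub_pow_le hγ hγ1 t
      _ = _ := by ring

/-- The total weight `∑ (1 - γ)^k` with which the signal at time `s` enters the states at the times
`t + l + 1`, `1 ≤ t ≤ n`. -/
def influence (γ : ℝ) (n l s : ℕ) : ℝ :=
  ∑ t ∈ Finset.Icc 1 n, ∑ k ∈ Finset.range (n + l), if t + l = s + k then (1 - γ) ^ k else 0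

theorem influence_nonneg (hγ1 : γ ≤ 1) (n l s : ℕ) : 0 ≤ influence γ n l s :=
  Finset.sum_nonneg fun t _ => Finset.sum_nonneg fun k _ => by
    have := pow_nonneg (sub_nonneg.2 hγ1) k
    split_ifs <;> simp [this]

theorem influence_le (hγ : 0 < γ) (hγ1 : γ ≤ 1) (n l s : ℕ) : influence γ n l s ≤ 1 / γ := by
  rw [influence, Finset.sum_comm]
  refine le_trans (Finset.sum_le_sum fun k _ => ?_) (sum_range_one_sub_pow_le hγ hγ1 (n + l))
  have hp := pow_nonneg (sub_nonneg.2 hγ1) k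
  -- For given s and k at most one t contributes. The subtraction truncates, so only an inequality
  -- is claimed.
  calc _ ≤ ∑ t ∈ Finset.Icc 1 n, if t = s + k - l then (1 - γ) ^ k else 0 := by
        refine Finset.sum_le_sum fun t _ => ?_
        by_cases h : t + l = s + k
        · rw [if_pos h, if_pos (by omega)]
        · rw [if_neg h]; split_ifs <;> simp [hp]
    _ ≤ _ := by
        rw [Finset.sum_ite_eq']
        split_ifs <;> simp [hp]

theorem sum_influence_le (hγ : 0 < γ) (hγ1 : γ ≤ 1) (n l T : ℕ) :
    ∑ s ∈ Finset.range T, influence γ n l s ≤ n / γ := by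
  simp only [influence]
  rw [Finset.sum_comm]
  have h : ∀ t ∈ Finset.Icc 1 n, ∑ s ∈ Finset.range T, ∑ k ∈ Finset.range (n + l),
      (if t + l = s + k then (1 - γ) ^ k else 0) ≤ 1 / γ := by
    intro t _
    rw [Finset.sum_comm]
    refine le_trans (Finset.sum_le_sum fun k _ => ?_) (sum_range_one_sub_pow_le hγ hγ1 (n + l))
    have hp := pow_nonneg (sub_nonneg.2 hγ1) k
    calc _ ≤ ∑ s ∈ Finset.range T, if s = t + l - k then (1 - γ) ^ k else 0 := by
          refine Finset.sum_le_sum fun s _ => ?_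
          by_cases h : t + l = s + k
          · rw [if_pos h, if_pos (by omega)]
          · rw [if_neg h]; split_ifs <;> simp [hp]
      _ ≤ _ := by
          rw [Finset.sum_ite_eq']
          split_ifs <;> simp [hp]
  refine (Finset.sum_le_sum h).trans (le_of_eq ?_)
  simp [div_eq_mul_inv]

/-- The scale `κ³ d₂ W / γ` of one term `x ξᵀ` of the moments. -/
noncomputable def momentScale (d₂ : ℕ) (κ γ W : ℝ) : ℝ := κ ^ 3 * d₂ * W / γ

/-- Bound for the change of `∑ₜ x_{t+l+1} ξₜᵀ` when the signal at time `s` changes. -/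
noncomputable def momentVariation (d₂ : ℕ) (κ γ W : ℝ) (n l s : ℕ) : ℝ :=
  2 * momentScale d₂ κ γ W * (γ * influence γ n l s) +
    4 * momentScale d₂ κ γ W * if s ∈ Finset.Icc 1 n then 1 else 0

/-- The growth is linear in n because g = γ · `influence` lies in [0, 1] and sums to at most n over
s, so g² may be replaced by g. The constant is 8 + 32, from (2g + 4)² ≤ 8g² + 32. -/
theorem sum_momentVariation_sq_le (hγ : 0 < γ) (hγ1 : γ ≤ 1) (n l T : ℕ) :
    ∑ s ∈ Finset.range T, momentVariation d₂ κ γ W n l s ^ 2 ≤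
      40 * momentScale d₂ κ γ W ^ 2 * n := by
  set M := momentScale d₂ κ γ W
  have h : ∀ s ∈ Finset.range T, momentVariation d₂ κ γ W n l s ^ 2 ≤
      8 * M ^ 2 * γ * influence γ n l s + 32 * M ^ 2 * if s ∈ Finset.Icc 1 n then 1 else 0 := by
    intro s _
    have h0 : 0 ≤ γ * influence γ n l s := mul_nonneg hγ.le (influence_nonneg hγ1 n l s)
    have h1 : γ * influence γ n l s ≤ 1 := by
      have := influence_le hγ hγ1 n l s
      rwa [le_div_iff₀ hγ, mul_comm] at this
    rw [momentVariation]
    set g := γ * influence γ n l s with hg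
    rw [show 8 * M ^ 2 * γ * influence γ n l s = 8 * M ^ 2 * g by rw [hg]; ring]
    have h2 : M ^ 2 * g ^ 2 ≤ M ^ 2 * g :=
      mul_le_mul_of_nonneg_left (by nlinarith) (sq_nonneg M)
    have h3 : M ^ 2 * g ≤ M ^ 2 := mul_le_of_le_one_right (sq_nonneg M) h1
    split_ifs <;> nlinarith [mul_nonneg (sq_nonneg M) h0, sq_nonneg (M * (g - 2))]
  refine (Finset.sum_le_sum h).trans ?_
  rw [Finset.sum_add_distrib, ← Finset.mul_sum, ← Finset.mul_sum]
  have h4 := sum_influence_le hγ hγ1 n l T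
  have h5 : ∑ s ∈ Finset.range T, (if s ∈ Finset.Icc 1 n then (1 : ℝ) else 0) ≤ n := by
    rw [Finset.sum_boole]
    have : ((Finset.range T).filter fun s => s ∈ Finset.Icc 1 n).card ≤ (Finset.Icc 1 n).card :=
      Finset.card_le_card fun s hs => (Finset.mem_filter.1 hs).2
    rw [Nat.card_Icc, Nat.add_sub_cancel] at this
    exact_mod_cast this
  calc _ ≤ 8 * M ^ 2 * γ * (n / γ) + 32 * M ^ 2 * n := by gcongr
    _ = _ := by field_simp; ring

/-- The difference x'ξ'ᵀ - xξᵀ splits as (x' - x)ξ'ᵀ + x(ξ' - ξ)ᵀ. The disturbances cancel in x' -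
x, whose contributions add up to `influence`; the second part is present only at t = s. -/
theorem norm_sub_sum_vecMulVec_le (hd₁ : 0 < d₁) (hd₂ : 0 < d₂) (hκ : 1 ≤ κ) (hW : 1 ≤ W)
    (hB : ‖B‖ ≤ κ) (hw : ∀ t, ‖WithLp.toLp 2 (w t)‖ ≤ W) (hst : StronglyStable A B K κ γ)
    {ξ ξ' : ℕ → Fin d₂ → ℝ} (hξ : ∀ t, ‖WithLp.toLp 2 (ξ t)‖ ≤ Real.sqrt d₂)
    (hξ' : ∀ t, ‖WithLp.toLp 2 (ξ' t)‖ ≤ Real.sqrt d₂) {s : ℕ} (hs : ∀ t ≠ s, ξ' t = ξ t)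
    (n l : ℕ) :
    ‖frobVec (∑ t ∈ Finset.Icc 1 n,
          Matrix.vecMulVec (explorationState A B K w ξ' (t + l + 1)) (ξ' t) -
        ∑ t ∈ Finset.Icc 1 n,
          Matrix.vecMulVec (explorationState A B K w ξ (t + l + 1)) (ξ t))‖ ≤
      momentVariation d₂ κ γ W n l s := by
  have hγ := hst.2.1
  have hγ1 := hst.2.2.1
  have hdsq : Real.sqrt d₂ * Real.sqrt d₂ = d₂ := Real.mul_self_sqrt (Nat.cast_nonneg _)
  have hΔ : ∀ t, ‖WithLp.toLp 2 (ξ' t - ξ t)‖ ≤ if t = s then 2 * Real.sqrt d₂ else 0 := by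
    intro t
    split_ifs with h
    · rw [WithLp.toLp_sub]
      exact (norm_sub_le _ _).trans (by linarith [hξ t, hξ' t])
    · rw [hs t h, sub_self, WithLp.toLp_zero, norm_zero]
  have hx : ∀ t ∈ Finset.Icc 1 n, ‖WithLp.toLp 2 (explorationState A B K w ξ' (t + l + 1) -
      explorationState A B K w ξ (t + l + 1))‖ ≤ 2 * κ ^ 3 * Real.sqrt d₂ *
        ∑ k ∈ Finset.range (n + l), if t + l = s + k then (1 - γ) ^ k else 0 := by
    intro t ht
    rw [Finset.mem_Icc] at ht
    rw [explorationState_succ, explorationState_succ, ← Finset.sum_sub_distrib, WithLp.toLp_sum]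
    calc _ ≤ ∑ k ∈ Finset.range (t + l), 2 * κ ^ 3 * Real.sqrt d₂ *
          if t + l = s + k then (1 - γ) ^ k else 0 := by
          refine norm_sum_le_of_le _ fun k hk => ?_
          rw [Finset.mem_range] at hk
          rw [← Matrix.mulVec_sub, add_sub_add_right_eq_sub, ← Matrix.mulVec_sub,
            Matrix.mulVec_mulVec]
          refine (norm_mulVec_le _ _).trans ?_
          have h1 : ‖(A - B * K) ^ k * B‖ ≤ κ ^ 2 * (1 - γ) ^ k * κ :=
            (Matrix.l2_opNorm_mul _ _).trans (mul_le_mul (hst.norm_pow_le hd₁ k) hB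
              (norm_nonneg _) (mul_nonneg (sq_nonneg _) (pow_nonneg (sub_nonneg.2 hγ1) _)))
          refine (mul_le_mul h1 (hΔ _) (norm_nonneg _) (mul_nonneg (mul_nonneg (sq_nonneg _)
            (pow_nonneg (sub_nonneg.2 hγ1) _)) (by linarith))).trans (le_of_eq ?_)
          by_cases h : t + l = s + k
          · rw [if_pos h, if_pos (by omega)]; ring
          · rw [if_neg h, if_neg (by omega)]; ring
      _ = 2 * κ ^ 3 * Real.sqrt d₂ *
          ∑ k ∈ Finset.range (t + l), if t + l = s + k then (1 - γ) ^ k else 0 := by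
          rw [Finset.mul_sum]
      _ ≤ _ := by
          refine mul_le_mul_of_nonneg_left ?_ (by positivity)
          -- Enlarging the range of k to one independent of t lets the sums in `influence` be
          -- exchanged.
          refine Finset.sum_le_sum_of_subset_of_nonneg
            (Finset.range_subset_range.2 (by omega)) fun k _ _ => ?_
          have := pow_nonneg (sub_nonneg.2 hγ1) k
          split_ifs <;> simp [this]
  rw [← Finset.sum_sub_distrib, map_sum]
  set R := 2 * κ ^ 3 * Real.sqrt d₂ * W / γ with hR
  have hR0 : 0 ≤ R := by positivity
  calc _ ≤ ∑ t ∈ Finset.Icc 1 n, ((2 * κ ^ 3 * Real.sqrt d₂ *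
        ∑ k ∈ Finset.range (n + l), if t + l = s + k then (1 - γ) ^ k else 0) * Real.sqrt d₂ +
          R * if t = s then 2 * Real.sqrt d₂ else 0) := by
        refine norm_sum_le_of_le _ fun t ht => ?_
        have : Matrix.vecMulVec (explorationState A B K w ξ' (t + l + 1)) (ξ' t) -
            Matrix.vecMulVec (explorationState A B K w ξ (t + l + 1)) (ξ t) =
            Matrix.vecMulVec (explorationState A B K w ξ' (t + l + 1) -
              explorationState A B K w ξ (t + l + 1)) (ξ' t) +
            Matrix.vecMulVec (explorationState A B K w ξ (t + l + 1)) (ξ' t - ξ t) := by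
          rw [Matrix.sub_vecMulVec, Matrix.vecMulVec_sub]; abel
        rw [this, map_add]
        refine (norm_add_le _ _).trans ?_
        rw [norm_frobVec_vecMulVec, norm_frobVec_vecMulVec]
        refine add_le_add ?_ ?_
        · exact mul_le_mul (hx t ht) (hξ' t) (norm_nonneg _) ((norm_nonneg _).trans (hx t ht))
        · exact mul_le_mul (norm_explorationState_le hd₁ hd₂ hκ hW hB hw hst hξ _) (hΔ t)
            (norm_nonneg _) hR0
    _ = 2 * κ ^ 3 * (Real.sqrt d₂ * Real.sqrt d₂) * influence γ n l s +
        R * if s ∈ Finset.Icc 1 n then 2 * Real.sqrt d₂ else 0 := by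
        rw [Finset.sum_add_distrib, ← Finset.sum_mul, ← Finset.mul_sum, ← Finset.mul_sum,
          Finset.sum_ite_eq', influence]
        ring
    _ ≤ _ := by
        rw [hdsq, momentVariation]
        refine add_le_add ?_ (le_of_eq ?_)
        · have hi := influence_nonneg hγ1 n l s
          have : 2 * momentScale d₂ κ γ W * (γ * influence γ n l s) =
              2 * κ ^ 3 * d₂ * influence γ n l s * W := by
            rw [momentScale]; field_simp
          rw [this]
          exact le_mul_of_one_le_right (by positivity) hW
        · split_ifs
          · rw [hR, momentScale]
            linear_combination 4 * κ ^ 3 * W / γ * hdsq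
          · ring

theorem norm_frobVec_localMoment_le (hd₁ : 0 < d₁) (hd₂ : 0 < d₂) (hκ : 1 ≤ κ) (hW : 1 ≤ W)
    (hB : ‖B‖ ≤ κ) (hw : ∀ t, ‖WithLp.toLp 2 (w t)‖ ≤ W) (hst : StronglyStable A B K κ γ)
    {ξ : ℕ → Fin d₂ → ℝ} (hξ : ∀ t, ‖WithLp.toLp 2 (ξ t)‖ ≤ Real.sqrt d₂) {q Tc : ℕ}
    (hT : q + 1 < Tc) (l : ℕ) :
    ‖frobVec (localMoment q Tc (explorationState A B K w ξ) ξ l)‖ ≤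
      2 * momentScale d₂ κ γ W := by
  have hn : (0 : ℝ) < (Tc : ℝ) - ((q : ℝ) + 1) := by
    have : ((q + 1 : ℕ) : ℝ) < Tc := by exact_mod_cast hT
    push_cast at this
    linarith
  have hγ := hst.2.1
  rw [localMoment, map_smul, norm_smul, Real.norm_of_nonneg (by positivity), one_div,
    inv_mul_le_iff₀ hn, map_sum]
  have : ∀ t ∈ Finset.Icc 1 (Tc - (q + 1)), ‖frobVec (Matrix.vecMulVec
      (explorationState A B K w ξ (t + l + 1)) (ξ t))‖ ≤ 2 * momentScale d₂ κ γ W := by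
    intro t _
    rw [norm_frobVec_vecMulVec]
    refine (mul_le_mul (norm_explorationState_le hd₁ hd₂ hκ hW hB hw hst hξ _) (hξ t)
      (norm_nonneg _) (by positivity)).trans (le_of_eq ?_)
    have hdsq : Real.sqrt d₂ * Real.sqrt d₂ = d₂ := Real.mul_self_sqrt (Nat.cast_nonneg _)
    rw [momentScale]
    linear_combination 2 * κ ^ 3 * W / γ * hdsq
  refine (norm_sum_le_of_le _ this).trans (le_of_eq ?_)
  rw [Finset.sum_const, Nat.card_Icc, nsmul_eq_mul, Nat.add_sub_cancel, Nat.cast_sub hT.le]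
  push_cast
  ring

end Dynamics

end DistributedSysId

namespace DistributedSysId

/-! ### The space of sign patterns -/

section Signs

variable {m d T : ℕ}

/-- The sign vector with `+1` at the entries where `b` is true. -/
def signVec (b : Fin d → Bool) : Fin d → ℝ := fun a => if b a then 1 else -1

theorem signVec_injective : Function.Injective (signVec (d := d)) := by
  intro b b' h
  ext a
  have := congrFun h a
  simp only [signVec] at this
  cases hb : b a <;> cases hb' : b' a <;> simp [hb, hb'] at this ⊢ <;> norm_num at this

theorem range_signVec : Set.range (signVec (d := d)) = signCube d := by
  ext v
  constructor
  · rintro ⟨b, rfl⟩ a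
    simp only [signVec]
    split_ifs <;> simp
  · intro hv
    refine ⟨fun a => decide (v a = 1), funext fun a => ?_⟩
    rcases hv a with h | h <;> simp [signVec, h]
    norm_num

theorem norm_signVec (b : Fin d → Bool) : ‖WithLp.toLp 2 (signVec b)‖ = Real.sqrt d := by
  rw [EuclideanSpace.norm_eq]
  congr 1
  have : ∀ a, ‖signVec b a‖ ^ 2 = 1 := by
    intro a
    simp only [signVec]
    split_ifs <;> simp
  rw [Finset.sum_congr rfl fun a _ => this a]
  simp

/-- The signals of all agents before time `T` read off from a sign pattern; they are constant from
time `T` on. -/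
def signals (x : Fin m × Fin T → Fin d → Bool) (i : Fin m) (t : ℕ) : Fin d → ℝ :=
  signVec (if h : t < T then x (i, ⟨t, h⟩) else fun _ => true)

theorem norm_signals (x : Fin m × Fin T → Fin d → Bool) (i : Fin m) (t : ℕ) :
    ‖WithLp.toLp 2 (signals x i t)‖ = Real.sqrt d := norm_signVec _

theorem signals_update_of_ne (x : Fin m × Fin T → Fin d → Bool) (p : Fin m × Fin T)
    (b : Fin d → Bool) {i : Fin m} {t : ℕ} (h : i ≠ p.1 ∨ t ≠ p.2) :
    signals (Function.update x p b) i t = signals x i t := by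
  unfold signals
  split_ifs with ht
  · rw [Function.update_of_ne]
    rintro rfl
    simp at h
  · rfl

/-- Flip the sign at entry `c` of the signal `p`. -/
def flipSign (p : Fin m × Fin T) (c : Fin d) (x : Fin m × Fin T → Fin d → Bool) :
    Fin m × Fin T → Fin d → Bool :=
  Function.update x p (Function.update (x p) c (!x p c))

theorem flipSign_involutive (p : Fin m × Fin T) (c : Fin d) :
    Function.Involutive (flipSign p c) := by
  intro x
  simp [flipSign]

theorem signals_flipSign (x : Fin m × Fin T → Fin d → Bool) (i : Fin m) {s t : ℕ} (hs : s < T)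
    (b c : Fin d) :
    signals (flipSign (i, ⟨s, hs⟩) c x) i t b =
      if t = s ∧ b = c then -signals x i t b else signals x i t b := by
  by_cases hts : t = s
  · subst hts
    simp only [signals, hs, dif_pos, flipSign, Function.update_self, signVec, true_and]
    by_cases hbc : b = c
    · subst hbc
      cases h : x (i, ⟨t, hs⟩) b <;> simp
    · rw [Function.update_of_ne hbc, if_neg hbc]
  · rw [flipSign, signals_update_of_ne _ _ _ (Or.inr hts), if_neg (by tauto)]

/-- A sum is invariant under the bijection that flips one sign, so an odd summand adds up to zero.
All first and second moments of the signals come from this symmetry. -/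
theorem sum_eq_zero_of_flipSign {f : (Fin m × Fin T → Fin d → Bool) → ℝ} (p : Fin m × Fin T)
    (c : Fin d) (h : ∀ x, f (flipSign p c x) = -f x) : ∑ x, f x = 0 := by
  have h1 := Equiv.sum_comp (Function.Involutive.toPerm _ (flipSign_involutive p c)) f
  have h2 : ∑ x, f (Function.Involutive.toPerm _ (flipSign_involutive p c) x) = -∑ x, f x := by
    rw [← Finset.sum_neg_distrib]
    exact Finset.sum_congr rfl fun x _ => h x
  linarith

theorem sum_signals (i : Fin m) {t : ℕ} (ht : t < T) (b : Fin d) :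
    ∑ x : Fin m × Fin T → Fin d → Bool, signals x i t b = 0 :=
  sum_eq_zero_of_flipSign (i, ⟨t, ht⟩) b fun x => by rw [signals_flipSign]; simp

theorem sum_signals_mul (i : Fin m) {s t : ℕ} (hs : s < T) (b c : Fin d) :
    ∑ x : Fin m × Fin T → Fin d → Bool, signals x i s c * signals x i t b =
      if s = t ∧ c = b then (Fintype.card (Fin m × Fin T → Fin d → Bool) : ℝ) else 0 := by
  split_ifs with h
  · obtain ⟨rfl, rfl⟩ := h
    have : ∀ x : Fin m × Fin T → Fin d → Bool, signals x i s c * signals x i s c = 1 := by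
      intro x
      simp only [signals, signVec]
      split_ifs <;> norm_num
    simp [this]
  · refine sum_eq_zero_of_flipSign (i, ⟨s, hs⟩) c fun x => ?_
    rw [signals_flipSign, signals_flipSign, if_pos ⟨rfl, rfl⟩, if_neg fun h' => h ⟨h'.1.symm, h'.2.symm⟩]
    ring

/-- Unbiasedness. The terms in w are fixed vectors times a mean-zero signal, and by orthogonality of
the signs ξ_{t+l-k} is correlated with ξ_t only for k = l. -/
theorem sum_localMoment_sub {d₁ : ℕ} (A : Matrix (Fin d₁) (Fin d₁) ℝ)
    (B : Matrix (Fin d₁) (Fin d) ℝ) (K : Matrix (Fin d) (Fin d₁) ℝ) (w : ℕ → Fin d₁ → ℝ)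
    {q Tc l : ℕ} (hT : q + 1 < Tc) (hl : l ≤ q) (i : Fin m) :
    ∑ x : Fin m × Fin Tc → Fin d → Bool,
      (localMoment q Tc (explorationState A B K w (signals x i)) (signals x i) l -
        (A - B * K) ^ l * B) = 0 := by
  have hn : (0 : ℝ) < (Tc : ℝ) - ((q : ℝ) + 1) := by
    have : ((q + 1 : ℕ) : ℝ) < Tc := by exact_mod_cast hT
    push_cast at this
    linarith
  rw [Finset.sum_sub_distrib, sub_eq_zero]
  simp only [localMoment, ← Finset.smul_sum]
  rw [Finset.sum_comm]
  have key : ∀ t ∈ Finset.Icc 1 (Tc - (q + 1)),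
      ∑ x : Fin m × Fin Tc → Fin d → Bool, Matrix.vecMulVec
        (explorationState A B K w (signals x i) (t + l + 1)) (signals x i t) =
      (Fintype.card (Fin m × Fin Tc → Fin d → Bool) : ℝ) • ((A - B * K) ^ l * B) := by
    intro t ht
    rw [Finset.mem_Icc] at ht
    ext a b
    simp only [Matrix.sum_apply, Matrix.vecMulVec_apply, Matrix.smul_apply, smul_eq_mul,
      explorationState_succ, Finset.sum_apply, Finset.sum_mul]
    rw [Finset.sum_comm]
    have hk : ∀ k ∈ Finset.range (t + l), ∑ x : Fin m × Fin Tc → Fin d → Bool,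
        ((A - B * K) ^ k *ᵥ (B *ᵥ signals x i (t + l - k) + w (t + l - k))) a * signals x i t b =
        if k = l then (Fintype.card (Fin m × Fin Tc → Fin d → Bool) : ℝ) *
          ((A - B * K) ^ l * B) a b else 0 := by
      intro k hk
      rw [Finset.mem_range] at hk
      have hx : ∀ x : Fin m × Fin Tc → Fin d → Bool,
          ((A - B * K) ^ k *ᵥ (B *ᵥ signals x i (t + l - k) + w (t + l - k))) a *
            signals x i t b = (∑ c, ((A - B * K) ^ k * B) a c *
              (signals x i (t + l - k) c * signals x i t b)) +
            ((A - B * K) ^ k *ᵥ w (t + l - k)) a * signals x i t b := by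
        intro x
        rw [Matrix.mulVec_add, Matrix.mulVec_mulVec, Pi.add_apply, add_mul]
        congr 1
        rw [Matrix.mulVec, dotProduct, Finset.sum_mul]
        exact Finset.sum_congr rfl fun c _ => mul_assoc _ _ _
      simp only [hx]
      rw [Finset.sum_add_distrib, ← Finset.mul_sum, sum_signals i (by omega), mul_zero, add_zero,
        Finset.sum_comm]
      simp only [← Finset.mul_sum]
      rw [Finset.sum_congr rfl fun c _ => by rw [sum_signals_mul i (by omega) b c]]
      by_cases h : k = l
      · subst h
        simp [mul_comm]
      · rw [if_neg h]
        refine Finset.sum_eq_zero fun c _ => ?_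
        rw [if_neg fun h' => h (by omega), mul_zero]
    rw [Finset.sum_congr rfl hk, Finset.sum_ite_eq', if_pos (Finset.mem_range.2 (by omega))]
  rw [Finset.sum_congr rfl key, Finset.sum_const, Finset.sum_const, Finset.card_univ, Nat.card_Icc,
    Nat.add_sub_cancel, ← Nat.cast_smul_eq_nsmul ℝ, ← Nat.cast_smul_eq_nsmul ℝ, smul_smul,
    Nat.cast_sub hT.le]
  push_cast
  rw [one_div, inv_mul_cancel₀ hn.ne', one_smul]

/-! ### From sign patterns to the exploration noise -/

theorem uniformOn_signCube_singleton (b : Fin d → Bool) :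
    uniformOn (signCube d) {signVec b} = ((2 : ENNReal) ^ d)⁻¹ := by
  have hfin : (signCube d).Finite := by
    rw [← range_signVec]; exact Set.finite_range _
  have hmem : signVec b ∈ signCube d := range_signVec ▸ Set.mem_range_self b
  have hcard : Measure.count (signCube d) = (2 : ENNReal) ^ d := by
    rw [← range_signVec, ← Set.image_univ, Measure.count_injective_image signVec_injective]
    simp [Measure.count_apply, ENat.card_eq_coe_fintype_card]
  rw [uniformOn, cond_apply hfin.measurableSet, hcard,
    Set.inter_eq_right.2 (Set.singleton_subset_iff.2 hmem), Measure.count_singleton, mul_one]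

theorem IsExplorationNoise.measure_signals_eq {Ω : Type*} [MeasurableSpace Ω] {μ : Measure Ω}
    {ξ : Fin m → ℕ → Ω → Fin d → ℝ} (h : IsExplorationNoise μ ξ)
    (x : Fin m × Fin T → Fin d → Bool) :
    μ {ω | ∀ i, ∀ t < T, ξ i t ω = signals x i t} =
      (Fintype.card (Fin m × Fin T → Fin d → Bool) : ENNReal)⁻¹ := by
  have hind := h.indep.precomp (g := fun p : Fin m × Fin T => (p.1, (p.2 : ℕ)))
    fun p p' hp => by
      simp only [Prod.mk.injEq] at hp
      exact Prod.ext hp.1 (Fin.ext hp.2)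
  have h1 := hind.measure_inter_preimage_eq_mul Finset.univ
    (sets := fun p => {signVec (x p)}) fun p _ => MeasurableSet.singleton _
  have hset : {ω | ∀ i, ∀ t < T, ξ i t ω = signals x i t} =
      ⋂ p ∈ (Finset.univ : Finset (Fin m × Fin T)),
        (fun p : Fin m × Fin T => ξ p.1 (p.2 : ℕ)) p ⁻¹' {signVec (x p)} := by
    ext ω
    simp only [Set.mem_ofPred_eq, Finset.mem_univ, Set.iInter_true, Set.mem_iInter,
      Set.mem_preimage, Set.mem_singleton_iff]
    constructor
    · intro hω p
      rw [hω p.1 p.2 p.2.2, signals, dif_pos p.2.2]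
    · intro hω i t ht
      rw [hω (i, ⟨t, ht⟩), signals, dif_pos ht]
  rw [hset, h1]
  have hp : ∀ p : Fin m × Fin T, μ ((fun p : Fin m × Fin T => ξ p.1 (p.2 : ℕ)) p ⁻¹'
      {signVec (x p)}) = ((2 : ENNReal) ^ d)⁻¹ := by
    intro p
    rw [← uniformOn_signCube_singleton (x p), ← h.law p.1 p.2,
      Measure.map_apply (h.measurable _ _) (MeasurableSet.singleton _)]
  rw [Finset.prod_congr rfl fun p _ => hp p, Finset.prod_const, ENNReal.inv_pow]
  simp [Fintype.card_pi, ENNReal.inv_pow]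

theorem IsExplorationNoise.ae_exists_signals {Ω : Type*} [MeasurableSpace Ω] {μ : Measure Ω}
    {ξ : Fin m → ℕ → Ω → Fin d → ℝ} (h : IsExplorationNoise μ ξ) (T : ℕ) :
    ∀ᵐ ω ∂μ, ∃ x : Fin m × Fin T → Fin d → Bool, ∀ i, ∀ t < T, ξ i t ω = signals x i t := by
  have hfin : (signCube d).Finite := by
    rw [← range_signVec]; exact Set.finite_range _
  have h1 : ∀ᵐ ω ∂μ, ∀ p : Fin m × Fin T, ξ p.1 p.2 ω ∈ signCube d := by
    rw [ae_all_iff]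
    intro p
    have h2 : ∀ᵐ v ∂(μ.map (ξ p.1 p.2)), v ∈ signCube d := by
      rw [h.law]
      exact ae_cond_mem hfin.measurableSet
    exact ae_of_ae_map (h.measurable _ _).aemeasurable h2
  filter_upwards [h1] with ω hω
  have h3 : ∀ p : Fin m × Fin T, ∃ b, signVec b = ξ p.1 p.2 ω := fun p => by
    have := hω p
    rwa [← range_signVec] at this
  choose x hx using h3
  refine ⟨x, fun i t ht => ?_⟩
  rw [signals, dif_pos ht, hx]

/-- Every sign pattern has the same probability, so the fraction of bad patterns bounds the failure
probability. -/
theorem IsExplorationNoise.le_measure {Ω : Type*} [MeasurableSpace Ω] {μ : Measure Ω}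
    [IsProbabilityMeasure μ] {ξ : Fin m → ℕ → Ω → Fin d → ℝ} (h : IsExplorationNoise μ ξ)
    {δ : ℝ} (hδ : 0 ≤ δ) {G : Set Ω} {Bad : Finset (Fin m × Fin T → Fin d → Bool)}
    (hBad : (Bad.card : ℝ) ≤ δ * Fintype.card (Fin m × Fin T → Fin d → Bool))
    (hG : ∀ ω, ∀ x ∉ Bad, (∀ i, ∀ t < T, ξ i t ω = signals x i t) → ω ∈ G) :
    ENNReal.ofReal (1 - δ) ≤ μ G := by
  set n := Fintype.card (Fin m × Fin T → Fin d → Bool) with hn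
  have hn0 : (n : ENNReal) ≠ 0 := by exact_mod_cast Fintype.card_ne_zero
  have hsub : μ Gᶜ ≤ μ (⋃ x ∈ Bad, {ω | ∀ i, ∀ t < T, ξ i t ω = signals x i t}) := by
    refine measure_mono_ae ?_
    filter_upwards [h.ae_exists_signals T] with ω ⟨x, hx⟩ hω
    by_contra hnot
    refine hω (hG ω x (fun hxB => hnot ?_) hx)
    exact Set.mem_iUnion₂.2 ⟨x, hxB, hx⟩
  have hle : μ Gᶜ ≤ ENNReal.ofReal δ := by
    refine hsub.trans ((measure_biUnion_finset_le _ _).trans ?_)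
    simp only [h.measure_signals_eq, Finset.sum_const, nsmul_eq_mul]
    rw [← div_eq_mul_inv, ENNReal.div_le_iff hn0 (ENNReal.natCast_ne_top n),
      ← ENNReal.ofReal_natCast, ← ENNReal.ofReal_natCast, ← ENNReal.ofReal_mul hδ]
    exact ENNReal.ofReal_le_ofReal hBad
  -- Subadditivity suffices here, so G need not be measurable.
  have huniv : 1 ≤ μ G + μ Gᶜ := by
    rw [← measure_univ (μ := μ), ← Set.union_compl_self G]
    exact measure_union_le _ _
  rw [ENNReal.ofReal_sub _ hδ, ENNReal.ofReal_one, tsub_le_iff_right]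
  exact huniv.trans (by gcongr)

end Signs

end DistributedSysId

namespace DistributedSysId

/-! ### Concentration of the averaged moments -/

section Main

variable {m d₁ d₂ q Tc : ℕ} {A : Matrix (Fin d₁) (Fin d₁) ℝ} {B : Matrix (Fin d₁) (Fin d₂) ℝ}
  {K : Matrix (Fin d₂) (Fin d₁) ℝ} {w : ℕ → Fin d₁ → ℝ} {κ γ W δ : ℝ}

/-- The moment averaged over all agents, for a given sign pattern. -/
noncomputable def meanMoment (A : Matrix (Fin d₁) (Fin d₁) ℝ) (B : Matrix (Fin d₁) (Fin d₂) ℝ)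
    (K : Matrix (Fin d₂) (Fin d₁) ℝ) (w : ℕ → Fin d₁ → ℝ) (q l : ℕ)
    (x : Fin m × Fin Tc → Fin d₂ → Bool) : Matrix (Fin d₁) (Fin d₂) ℝ :=
  (m : ℝ)⁻¹ • ∑ j, localMoment q Tc (explorationState A B K w (signals x j)) (signals x j) l

theorem sampleSize_pos (hm : 0 < m) (hT : q + 1 < Tc) :
    0 < (Tc : ℝ) - ((q : ℝ) + 1) ∧ 0 < sampleSize m q Tc := by
  have h : ((q + 1 : ℕ) : ℝ) < Tc := by exact_mod_cast hT
  push_cast at h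
  have h1 : 0 < (Tc : ℝ) - ((q : ℝ) + 1) := by linarith
  exact ⟨h1, mul_pos (by exact_mod_cast hm) h1⟩

theorem sum_meanMoment_sub (hm : 0 < m) (hT : q + 1 < Tc) {l : ℕ} (hl : l ≤ q) :
    ∑ x : Fin m × Fin Tc → Fin d₂ → Bool,
      (frobVec (meanMoment A B K w q l x) - frobVec ((A - B * K) ^ l * B)) = 0 := by
  have hm' : (m : ℝ) ≠ 0 := by exact_mod_cast hm.ne'
  have h : ∀ x : Fin m × Fin Tc → Fin d₂ → Bool,
      frobVec (meanMoment A B K w q l x) - frobVec ((A - B * K) ^ l * B) =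
        frobVec ((m : ℝ)⁻¹ • ∑ j,
          (localMoment q Tc (explorationState A B K w (signals x j)) (signals x j) l -
            (A - B * K) ^ l * B)) := by
    intro x
    rw [Finset.sum_sub_distrib, Finset.sum_const, Finset.card_univ, Fintype.card_fin,
      ← Nat.cast_smul_eq_nsmul ℝ, smul_sub, smul_smul, inv_mul_cancel₀ hm', one_smul, map_sub]
    rfl
  simp only [h]
  rw [← map_sum, ← Finset.smul_sum, Finset.sum_comm,
    Finset.sum_eq_zero fun j _ => sum_localMoment_sub A B K w hT hl j, smul_zero, map_zero]

theorem norm_meanMoment_update_sub_le (hd₁ : 0 < d₁) (hd₂ : 0 < d₂) (hκ : 1 ≤ κ)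
    (hW : 1 ≤ W) (hB : ‖B‖ ≤ κ) (hw : ∀ t, ‖WithLp.toLp 2 (w t)‖ ≤ W)
    (hst : StronglyStable A B K κ γ) (hm : 0 < m) (hT : q + 1 < Tc) (l : ℕ)
    (p : Fin m × Fin Tc) (x : Fin m × Fin Tc → Fin d₂ → Bool) (b : Fin d₂ → Bool) :
    ‖frobVec (meanMoment A B K w q l (Function.update x p b)) -
        frobVec (meanMoment A B K w q l x)‖ ≤
      (sampleSize m q Tc)⁻¹ * momentVariation d₂ κ γ W (Tc - (q + 1)) l p.2 := by
  obtain ⟨hn, hS⟩ := sampleSize_pos hm hT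
  set x' := Function.update x p b with hx'
  have hother : ∀ j, j ≠ p.1 → signals x' j = signals x j := fun j hj =>
    funext fun t => signals_update_of_ne x p b (Or.inl hj)
  have hdiff : meanMoment A B K w q l x' - meanMoment A B K w q l x = (sampleSize m q Tc)⁻¹ •
      (∑ t ∈ Finset.Icc 1 (Tc - (q + 1)), Matrix.vecMulVec
          (explorationState A B K w (signals x' p.1) (t + l + 1)) (signals x' p.1 t) -
        ∑ t ∈ Finset.Icc 1 (Tc - (q + 1)), Matrix.vecMulVec
          (explorationState A B K w (signals x p.1) (t + l + 1)) (signals x p.1 t)) := by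
    rw [meanMoment, meanMoment, ← smul_sub, ← Finset.sum_sub_distrib,
      Finset.sum_eq_single p.1 (fun j _ hj => by rw [hother j hj, sub_self]) (by simp),
      localMoment, localMoment, ← smul_sub, smul_smul, sampleSize, mul_inv, one_div]
  rw [← map_sub, hdiff, map_smul, norm_smul, Real.norm_of_nonneg (inv_pos.2 hS).le]
  refine mul_le_mul_of_nonneg_left ?_ (inv_pos.2 hS).le
  exact norm_sub_sum_vecMulVec_le hd₁ hd₂ hκ hW hB hw hst (fun t => (norm_signals x _ t).le)
    (fun t => (norm_signals x' _ t).le)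
    (fun t ht => signals_update_of_ne x p b (Or.inr ht)) _ l

theorem momentScale_pos (hd₂ : 0 < d₂) (hκ : 1 ≤ κ) (hW : 1 ≤ W) (hγ : 0 < γ) :
    0 < momentScale d₂ κ γ W := by
  have : (0 : ℝ) < d₂ := by exact_mod_cast hd₂
  rw [momentScale]
  positivity

/-- The variance proxy adds 40 M² (Tc - (q+1)) over m agents and scales by S⁻², leaving 40 M² / S.
-/
theorem card_meanMoment_deviation_le (hd₁ : 0 < d₁) (hd₂ : 0 < d₂) (hκ : 1 ≤ κ)
    (hW : 1 ≤ W) (hB : ‖B‖ ≤ κ) (hw : ∀ t, ‖WithLp.toLp 2 (w t)‖ ≤ W)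
    (hst : StronglyStable A B K κ γ) (hm : 0 < m) (hT : q + 1 < Tc) {l : ℕ} (hl : l ≤ q)
    {r : ℝ} (hr : 0 ≤ r) :
    (Nat.card {x : Fin m × Fin Tc → Fin d₂ → Bool // r ≤ ‖frobVec (meanMoment A B K w q l x) -
        frobVec ((A - B * K) ^ l * B)‖} : ℝ) ≤
      2 * Real.exp (-(r ^ 2 / (2 * (40 * momentScale d₂ κ γ W ^ 2 / sampleSize m q Tc)))) *
        Fintype.card (Fin m × Fin Tc → Fin d₂ → Bool) := by
  obtain ⟨hn, hS⟩ := sampleSize_pos hm hT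
  have hM := momentScale_pos hd₂ hκ hW hst.2.1
  refine card_norm_sub_ge_le _ _
    (norm_meanMoment_update_sub_le hd₁ hd₂ hκ hW hB hw hst hm hT l) _
    (sum_meanMoment_sub hm hT hl) (by positivity) ?_ hr
  rw [Fintype.sum_prod_type]
  simp only [mul_pow, ← Finset.mul_sum, Finset.sum_const, Finset.card_univ, Fintype.card_fin,
    nsmul_eq_mul]
  rw [Fin.sum_univ_eq_sum_range
    fun s => momentVariation d₂ κ γ W (Tc - (q + 1)) l s ^ 2]
  have h := sum_momentVariation_sq_le (d₂ := d₂) (κ := κ) (W := W) hst.2.1 hst.2.2.1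
    (Tc - (q + 1)) l Tc
  rw [Nat.cast_sub hT.le] at h
  push_cast at h
  calc _ ≤ (sampleSize m q Tc)⁻¹ ^ 2 * ((m : ℝ) *
        (40 * momentScale d₂ κ γ W ^ 2 * ((Tc : ℝ) - ((q : ℝ) + 1)))) := by gcongr
    _ = (sampleSize m q Tc)⁻¹ ^ 2 * (40 * momentScale d₂ κ γ W ^ 2 * sampleSize m q Tc) := by
        rw [sampleSize]; ring
    _ = _ := by field_simp

theorem exp_neg_logFactor_le (hm : 0 < m) (hd₁ : 0 < d₁) (hd₂ : 0 < d₂) (hδ : 0 < δ) :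
    Real.exp (-logFactor m d₁ d₂ q δ) ≤ δ / ((q : ℝ) + 1) := by
  have h1 : (1 : ℝ) ≤ d₁ := by exact_mod_cast hd₁
  have h2 : (1 : ℝ) ≤ d₂ := by exact_mod_cast hd₂
  have h3 : (1 : ℝ) ≤ m := by exact_mod_cast hm
  have hq : (0 : ℝ) < (q : ℝ) + 1 := by positivity
  rw [logFactor, ← Real.log_inv, Real.exp_log (by positivity), inv_div]
  refine div_le_div_of_nonneg_left hδ.le hq ?_
  calc (q : ℝ) + 1 = 1 * 1 * ((q : ℝ) + 1) * 1 := by ring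
    _ ≤ _ := by gcongr

theorem logFactor_pos (hm : 0 < m) (hd₁ : 0 < d₁) (hd₂ : 0 < d₂) (hδ : 0 < δ) (hδ1 : δ < 1) :
    0 < logFactor m d₁ d₂ q δ := by
  have h := exp_neg_logFactor_le (q := q) hm hd₁ hd₂ hδ
  have h1 : δ / ((q : ℝ) + 1) < 1 := by
    rw [div_lt_one (by positivity)]
    have : (0 : ℝ) ≤ q := Nat.cast_nonneg q
    linarith
  have := Real.exp_lt_one_iff.1 (h.trans_lt h1)
  linarith

theorem two_mul_exp_neg_two_logFactor_le (hm : 0 < m) (hd₁ : 0 < d₁) (hd₂ : 0 < d₂) (hδ : 0 < δ)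
    (hδ1 : δ < 1) (hq : 1 ≤ q) :
    ((q : ℝ) + 1) * (2 * Real.exp (-(2 * logFactor m d₁ d₂ q δ))) ≤ δ := by
  have h := exp_neg_logFactor_le (q := q) hm hd₁ hd₂ hδ
  have hq' : (1 : ℝ) ≤ q := by exact_mod_cast hq
  have hsq : Real.exp (-(2 * logFactor m d₁ d₂ q δ)) ≤ (δ / ((q : ℝ) + 1)) ^ 2 := by
    rw [show -(2 * logFactor m d₁ d₂ q δ) =
      -logFactor m d₁ d₂ q δ + -logFactor m d₁ d₂ q δ by ring, Real.exp_add, ← sq]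
    exact pow_le_pow_left₀ (Real.exp_pos _).le h 2
  -- Squaring δ/(q+1) pays for both the union over lags and the factor 2, since q + 1 ≥ 2 and δ < 1.
  calc _ ≤ ((q : ℝ) + 1) * (2 * (δ / ((q : ℝ) + 1)) ^ 2) := by gcongr
    _ = 2 * δ ^ 2 / ((q : ℝ) + 1) := by field_simp
    _ ≤ δ := by
        rw [div_le_iff₀ (by positivity)]
        nlinarith

open Classical in
/-- The sign patterns for which some averaged moment is far from its mean. -/
noncomputable def badPatterns (A : Matrix (Fin d₁) (Fin d₁) ℝ) (B : Matrix (Fin d₁) (Fin d₂) ℝ)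
    (K : Matrix (Fin d₂) (Fin d₁) ℝ) (w : ℕ → Fin d₁ → ℝ) (m q Tc : ℕ) (r : ℝ) :
    Finset (Fin m × Fin Tc → Fin d₂ → Bool) :=
  (Finset.range (q + 1)).biUnion fun l => Finset.univ.filter fun x =>
    r ≤ ‖frobVec (meanMoment A B K w q l x) - frobVec ((A - B * K) ^ l * B)‖

theorem card_badPatterns_le (hd₁ : 0 < d₁) (hd₂ : 0 < d₂) (hκ : 1 ≤ κ) (hW : 1 ≤ W)
    (hδ : 0 < δ) (hδ1 : δ < 1) (hB : ‖B‖ ≤ κ) (hw : ∀ t, ‖WithLp.toLp 2 (w t)‖ ≤ W)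
    (hst : StronglyStable A B K κ γ) (hm : 0 < m) (hq : 1 ≤ q) (hT : q + 1 < Tc) :
    ((badPatterns A B K w m q Tc (13 * momentScale d₂ κ γ W *
        Real.sqrt (logFactor m d₁ d₂ q δ / sampleSize m q Tc))).card : ℝ) ≤
      δ * Fintype.card (Fin m × Fin Tc → Fin d₂ → Bool) := by
  classical
  obtain ⟨hn, hS⟩ := sampleSize_pos hm hT
  have hM := momentScale_pos hd₂ hκ hW hst.2.1
  have hΛ := logFactor_pos (q := q) hm hd₁ hd₂ hδ hδ1
  set M := momentScale d₂ κ γ W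
  set S := sampleSize m q Tc
  set Λ := logFactor m d₁ d₂ q δ
  set r := 13 * M * Real.sqrt (Λ / S) with hr
  have hr0 : 0 ≤ r := by positivity
  have hexp : 2 * Λ ≤ r ^ 2 / (2 * (40 * M ^ 2 / S)) := by
    -- The constant 13 is the least integer whose square is at least 160, which makes the exponent
    -- at least 2Λ.
    have : r ^ 2 / (2 * (40 * M ^ 2 / S)) = 169 / 80 * Λ := by
      rw [hr, mul_pow, Real.sq_sqrt (by positivity)]
      field_simp
      ring
    rw [this]
    linarith
  have hcard : ∀ l ∈ Finset.range (q + 1), (((Finset.univ.filter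
      fun x : Fin m × Fin Tc → Fin d₂ → Bool => r ≤ ‖frobVec (meanMoment A B K w q l x) -
        frobVec ((A - B * K) ^ l * B)‖).card : ℕ) : ℝ) ≤
      2 * Real.exp (-(2 * Λ)) * Fintype.card (Fin m × Fin Tc → Fin d₂ → Bool) := by
    intro l hl
    have h := card_meanMoment_deviation_le hd₁ hd₂ hκ hW hB hw hst hm hT
      (Nat.lt_succ_iff.1 (Finset.mem_range.1 hl)) hr0
    rw [Nat.card_eq_fintype_card, Fintype.card_subtype] at h
    refine h.trans ?_
    gcongr
  have hu : ((badPatterns A B K w m q Tc r).card : ℝ) ≤ ∑ l ∈ Finset.range (q + 1),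
      (((Finset.univ.filter fun x : Fin m × Fin Tc → Fin d₂ → Bool =>
        r ≤ ‖frobVec (meanMoment A B K w q l x) - frobVec ((A - B * K) ^ l * B)‖).card : ℕ) : ℝ) := by
    rw [badPatterns]
    exact_mod_cast Finset.card_biUnion_le
  refine hu.trans ((Finset.sum_le_sum hcard).trans ?_)
  rw [Finset.sum_const, Finset.card_range, nsmul_eq_mul, ← mul_assoc]
  push_cast
  gcongr
  exact two_mul_exp_neg_two_logFactor_le hm hd₁ hd₂ hδ hδ1 hq

/-- Statistical and consensus errors add up: 16 = 13 + (3/2) · 2, with √2 ≤ 3/2 and 2M bounding each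
local moment. -/
theorem norm_finalMoment_sub_le {P : Matrix (Fin m) (Fin m) ℝ} {Te : ℕ} (hd₁ : 0 < d₁)
    (hd₂ : 0 < d₂) (hκ : 1 ≤ κ) (hW : 1 ≤ W) (hB : ‖B‖ ≤ κ)
    (hw : ∀ t, ‖WithLp.toLp 2 (w t)‖ ≤ W) (hst : StronglyStable A B K κ γ) (hm : 0 < m)
    (hT : q + 1 < Tc) (hP : IsNetworkMatrix P) {y : ℝ}
    (hTe : Real.sqrt m * secondSingularValue P ^ Te ≤ Real.sqrt (2 * y))
    {x : Fin m × Fin Tc → Fin d₂ → Bool}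
    (hx : x ∉ badPatterns A B K w m q Tc (13 * momentScale d₂ κ γ W * Real.sqrt y))
    {ξ : Fin m → ℕ → Fin d₂ → ℝ} (hξ : ∀ i, ∀ t < Tc, ξ i t = signals x i t) (i : Fin m) {l : ℕ}
    (hl : l ≤ q) :
    ‖frobVec (finalMoment A B K P q Tc Te w ξ i l - (A - B * K) ^ l * B)‖ ≤
      16 * momentScale d₂ κ γ W * Real.sqrt y := by
  have hM := momentScale_pos hd₂ hκ hW hst.2.1
  have hN : (fun j => localMoment q Tc (explorationState A B K w (ξ j)) (ξ j) l) = fun j =>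
      localMoment q Tc (explorationState A B K w (signals x j)) (signals x j) l :=
    funext fun j => localMoment_congr hl (hξ j)
  have h1 := hP.norm_exchange_sub_mean_le hm
    (N := fun j => localMoment q Tc (explorationState A B K w (signals x j)) (signals x j) l)
    (fun j => norm_frobVec_localMoment_le hd₁ hd₂ hκ hW hB hw hst
      (fun t => (norm_signals x j t).le) hT l) Te i
  have h2 : ‖frobVec (meanMoment A B K w q l x) - frobVec ((A - B * K) ^ l * B)‖ ≤
      13 * momentScale d₂ κ γ W * Real.sqrt y := by
    by_contra h
    refine hx ?_
    simp only [badPatterns, Finset.mem_biUnion, Finset.mem_range, Finset.mem_filter,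
      Finset.mem_univ, true_and]
    exact ⟨l, by omega, (not_le.1 h).le⟩
  have h3 : Real.sqrt (2 * y) ≤ 3 / 2 * Real.sqrt y := by
    rw [Real.sqrt_mul (by norm_num)]
    have : Real.sqrt 2 ≤ 3 / 2 := Real.sqrt_le_iff.2 ⟨by norm_num, by norm_num⟩
    gcongr
  rw [finalMoment, hN, map_sub]
  rw [map_sub] at h1
  refine (norm_sub_le_norm_sub_add_norm_sub _ (frobVec (meanMoment A B K w q l x)) _).trans ?_
  refine (add_le_add (h1.trans (mul_le_mul_of_nonneg_right (hTe.trans h3) (by positivity)))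
    h2).trans (le_of_eq (by ring))

end Main

end DistributedSysId

/-! ### Assembly of the theorem and choice of the constant -/

theorem mainTheorem3 :
    ∃ C : ℝ, 0 < C ∧
      ∀ (m d₁ d₂ q Tc Te : ℕ) (κ γ W δ : ℝ)
        (A : Matrix (Fin d₁) (Fin d₁) ℝ) (B : Matrix (Fin d₁) (Fin d₂) ℝ)
        (K : Matrix (Fin d₂) (Fin d₁) ℝ) (P : Matrix (Fin m) (Fin m) ℝ)
        (w : ℕ → Fin d₁ → ℝ)
        (Ω : Type*) [MeasurableSpace Ω] (μ : Measure Ω) [IsProbabilityMeasure μ]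
        (ξ : Fin m → ℕ → Ω → (Fin d₂ → ℝ)),
        0 < m → 0 < d₁ → 0 < d₂ →
        1 ≤ κ → 1 ≤ W → 0 < δ → δ < 1 →
        ‖A‖ ≤ κ → ‖B‖ ≤ κ → (∀ t, ‖WithLp.toLp 2 (w t)‖ ≤ W) →
        DistributedSysId.StronglyStable A B K κ γ →
        DistributedSysId.StronglyControllable (A - B * K) B q κ →
        DistributedSysId.IsNetworkMatrix P →
        DistributedSysId.IsExplorationNoise μ ξ →
        q + 1 < Tc →
        C * ((q : ℝ) * (d₂ : ℝ) ^ 2 * κ ^ 7 * W ^ 2 / γ ^ 2) *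
            DistributedSysId.logFactor m d₁ d₂ q δ ≤ DistributedSysId.sampleSize m q Tc →
        Real.sqrt m * DistributedSysId.secondSingularValue P ^ Te ≤
          Real.sqrt (2 * DistributedSysId.logFactor m d₁ d₂ q δ /
            DistributedSysId.sampleSize m q Tc) →
        ENNReal.ofReal (1 - δ) ≤ μ {ω | ∀ i : Fin m,
          let N : ℕ → Matrix (Fin d₁) (Fin d₂) ℝ :=
            DistributedSysId.finalMoment A B K P q Tc Te w (fun j t => ξ j t ω) i
          IsUnit (DistributedSysId.regressor q N * (DistributedSysId.regressor q N)ᵀ) ∧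
          ‖DistributedSysId.estimateA q K N - A‖ ≤
            C * DistributedSysId.estimationRate m d₁ d₂ q Tc κ γ W δ ∧
          ‖DistributedSysId.estimateB N - B‖ ≤
            C * DistributedSysId.estimationRate m d₁ d₂ q Tc κ γ W δ} := by
  open DistributedSysId in
  -- Here 1024 = 16² · 2²: squaring √q · 16M√(Λ/S) · 2√κ ≤ 1 gives exactly the assumed lower bound
  -- on S, with κ⁷ = (κ³)² κ.
  refine ⟨1024, by norm_num, ?_⟩
  intro m d₁ d₂ q Tc Te κ γ W δ A B K P w Ω _ μ _ ξ hm hd₁ hd₂ hκ hW hδ hδ1 hA hB hw hst hco hP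
    hξ hT hS hTe
  have hq : 1 ≤ q := hco.1
  obtain ⟨hn, hSpos⟩ := sampleSize_pos hm hT
  have hΛ := logFactor_pos (q := q) hm hd₁ hd₂ hδ hδ1
  have hγ := hst.2.1
  have hM := momentScale_pos hd₂ hκ hW hγ
  refine hξ.le_measure hδ.le
    (card_badPatterns_le hd₁ hd₂ hκ hW hδ hδ1 hB hw hst hm hq hT) ?_
  intro ω x hx hωx i
  dsimp only
  rw [mul_div_assoc] at hTe
  have hclose := fun l (hl : l ≤ q) => norm_finalMoment_sub_le hd₁ hd₂ hκ hW hB hw hst hm hT hP hTe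
    hx hωx i hl
  rw [estimationRate]
  set S := sampleSize m q Tc
  set Λ := logFactor m d₁ d₂ q δ
  have hκ0 : 0 < κ := by linarith
  have hsκ : 0 < Real.sqrt κ := Real.sqrt_pos.2 hκ0
  have hq1 : (1 : ℝ) ≤ q := by exact_mod_cast hq
  have hd1 : (1 : ℝ) ≤ d₁ := by exact_mod_cast hd₁
  have hd2 : (1 : ℝ) ≤ d₂ := by exact_mod_cast hd₂
  have hMeq : momentScale d₂ κ γ W = κ ^ 3 * d₂ * W / γ := rfl
  have hsmall : Real.sqrt q * (16 * momentScale d₂ κ γ W * Real.sqrt (Λ / S)) ≤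
      1 / (2 * Real.sqrt κ) := by
    rw [le_div_iff₀ (by positivity)]
    refine le_of_sq_le_sq ?_ zero_le_one
    simp only [mul_pow]
    rw [Real.sq_sqrt (by positivity), Real.sq_sqrt (by positivity), Real.sq_sqrt hκ0.le, one_pow,
      hMeq]
    calc (q : ℝ) * (16 ^ 2 * (κ ^ 3 * d₂ * W / γ) ^ 2 * (Λ / S)) * (2 ^ 2 * κ) =
        (1024 * ((q : ℝ) * (d₂ : ℝ) ^ 2 * κ ^ 7 * W ^ 2 / γ ^ 2) * Λ) / S := by
          field_simp
          ring
      _ ≤ 1 := by rwa [div_le_one hSpos]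
  obtain ⟨hu, hAerr, hBerr⟩ := estimates_of_moments_close hd₁ hκ hst hco (by positivity) hclose hsmall
  have hpow : κ ^ (11 / 2 : ℝ) = κ ^ 5 * Real.sqrt κ := by
    rw [Real.sqrt_eq_rpow, ← Real.rpow_natCast, ← Real.rpow_add hκ0]
    norm_num
  have hsq : Real.sqrt q ≤ Real.sqrt ((d₁ : ℝ) * q) :=
    Real.sqrt_le_sqrt (le_mul_of_one_le_left (by positivity) hd1)
  have hsq1 : 1 ≤ Real.sqrt ((d₁ : ℝ) * q) := (Real.one_le_sqrt.2 hq1).trans hsq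
  have hk1 : 1 ≤ Real.sqrt κ := Real.one_le_sqrt.2 hκ
  rw [hpow]
  refine ⟨hu, hAerr.trans ?_, hBerr.trans ?_⟩
  · rw [hMeq]
    -- The error of Â has 80 = 5 · 16 and κ^(11/2) = κ³ · κ² · √κ; the factor √d₁ in the rate is
    -- slack.
    calc _ = 80 * (d₂ * W * Real.sqrt q * (κ ^ 5 * Real.sqrt κ) / γ * Real.sqrt (Λ / S)) := by ring
      _ ≤ 1024 * (d₂ * W * Real.sqrt ((d₁ : ℝ) * q) * (κ ^ 5 * Real.sqrt κ) / γ *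
          Real.sqrt (Λ / S)) := by
        gcongr
        norm_num
  · rw [hMeq]
    calc _ = 16 * (d₂ * W * 1 * (κ ^ 3 * 1) / γ * Real.sqrt (Λ / S)) := by ring
      _ ≤ 1024 * (d₂ * W * Real.sqrt ((d₁ : ℝ) * q) * (κ ^ 5 * Real.sqrt κ) / γ *
          Real.sqrt (Λ / S)) := by
        gcongr
        · norm_num
        · norm_num
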